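/- **Setting.** Let $\mathcal S,\mathcal A$ be measurable spaces, $p_S$ a probability distribution of contexts on $\mathcal S$, $p_{R\mid S,A}$ a reward distribution (Markov kernel) on $[0,R_{\max}]$, and $\pi^{\mathrm e},\pi_1,\dots,\pi_K$ policies, i.e. conditional densities $\pi(a\mid s)$ with respect to a $\sigma$-finite base measure $\lambda$ on $\mathcal A$. Write $\mathbb E_\pi$ for the expectation under $p_S(ds)\,\pi(a\mid s)\lambda(da)\,p_{R\mid S,A}(dr\mid s,a)$ and $J=\mathbb E_{\pi^{\mathrm e}}[r]$. Fix stratum sizes $n_1,\dots,n_K\ge 0$ with $n=\sum_k n_k>0$; set $\rho_k=n_k/n$, $\mathbb E_{\pi_*}=\sum_k\rho_k\mathbb E_{\pi_k}$ and $\|f\|_2=(\mathbb E_{\pi_*}[f^2])^{1/2}=(\sum_k\rho_k\mathbb E_{\pi_k}[f(k,\cdot)^2])^{1/2}$. For each $k$ let $(S_{kj},A_{kj},R_{kj})_{j\ge1}$ be observations from $\pi_k$, all independent. For $m\ge 1$ put $n'_k=mn_k$, $n'=mn$, and observe the first $n'_k$ observations of each logger $k$; let $\mathcal D$ be the data for $m=1$.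 Assume $\mathbb E_{\pi_*}[\pi^{\mathrm e}(a\mid s)^2]<\infty$ (automatic if $\pi^{\mathrm e}(a\mid s)$ is bounded, in particular for discrete actions and counting measure $\lambda$). For a nonempty part $\mathcal L$ of the data and functions $h(k,s,a)$, $g(s,a)$, let $g(s,\pi^{\mathrm e})=\int g(s,a)\pi^{\mathrm e}(a\mid s)\lambda(da)$ and $$\Gamma(\mathcal L;h,g)=\frac1{|\mathcal L|}\sum_{(k,s,a,r)\in\mathcal L}\bigl[h(k,s,a)\,\pi^{\mathrm e}(a\mid s)\,(r-g(s,a))+g(s,\pi^{\mathrm e})\bigr].$$ Consider the constraint $$\textstyle\sum_{k=1}^K n_k\,\pi_k(a\mid s)\,h(k,s,a)=n\qquad\text{for all } s,a\text{ with }\pi^{\mathrm e}(a\mid s)>0.\tag{1}$$ **Estimator.** Fix an integer $Z\ge1$. For each $m$ and $k$ let $(I_{kz})_{z=1}^Z$ be a (random) partition of $\{1,\dots,n'_k\}$, drawn independently of the data, with $\bigl||I_{kz}|-n'_k/Z\bigr|\le 1$ for all $k,z$. Let $\mathcal L_z$ consist of the observations with indices in $I_{kz}$, $k=1,\dots,K$,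 and $\mathcal U_z$ of all the others; let $\hat h^{(z)}=\hat h(\cdot\,;\mathcal U_z)$ and $\hat g^{(z)}=\hat g(\cdot\,;\mathcal U_z)$ be estimators of $h$ and $g$ computed from $\mathcal U_z$ only, and $$\hat J_{\mathrm{BI}}=\hat J_{\mathrm{BI}}(\hat h,\hat g)=\frac1{n'}\sum_{z=1}^Z|\mathcal L_z|\,\Gamma(\mathcal L_z;\hat h^{(z)},\hat g^{(z)})$$ (empty folds contribute $0$). **Theorem.** Suppose that $\|\hat h^{(z)}-h\|_2\to0$ and $\|\hat g^{(z)}-g\|_2\to0$ in probability as $m\to\infty$ for every $z$, that $h,g,\hat h^{(z)},\hat g^{(z)}$ are uniformly bounded by a constant, and that $h$ and every $\hat h^{(z)}$ satisfy (1). Then: 1. For every $m\ge 1$ for which the folds almost surely contain the loggers in the right proportions, i.e. $|I_{kz}|=\rho_k|\mathcal L_z|$ for all $k,z$ (e.g. if $|I_{kz}|=n'_k/Z$), $\hat J_{\mathrm{BI}}$ is unbiased: it is integrable and $\mathbb E[\hat J_{\mathrm{BI}}]=J$. 2. In general $\hat J_{\mathrm{BI}}$ is integrable for every $m\ge1$,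 and $|\mathbb E[\hat J_{\mathrm{BI}}]-J|\le B/n'$ with a constant $B$ that does not depend on $m$. 3. $\Gamma(\mathcal D;h,g)$ has finite variance, and as $m\to\infty$ $$\sqrt{n'}\,\bigl(\hat J_{\mathrm{BI}}-J\bigr)\xrightarrow{d}\mathcal N\bigl(0,\;n\,\mathrm{var}[\Gamma(\mathcal D;h,g)]\bigr).$$ -/

import Mathlib

open MeasureTheory ProbabilityTheory Filter Topology

noncomputable section

namespace MultiLogger

/-- A policy on actions `A` given contexts `S`, as a conditional probability density `π(a ∣ s)` with
respect to the base measure `lam` on `A` (counting measure for discrete actions, Lebesgue measure for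
continuous ones, ...). -/
structure Policy (S : Type*) {A : Type*} [MeasurableSpace S] [MeasurableSpace A]
    (lam : Measure A) where
  dens : S → A → ℝ
  measurable_dens : Measurable (Function.uncurry dens)
  dens_nonneg : ∀ s a, 0 ≤ dens s a
  lintegral_dens : ∀ s, ∫⁻ a, ENNReal.ofReal (dens s a) ∂lam = 1

/-- An observation `((s, a), r)`; the reward lies in `[0, Rmax]`. -/
abbrev Obs (S A : Type*) (Rmax : ℝ) : Type _ := (S × A) × Set.Icc (0 : ℝ) Rmax

variable {S A : Type*} [MeasurableSpace S] [MeasurableSpace A] {lam : Measure A} {Rmax : ℝ}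

/-- The Markov kernel `s ↦ π(a ∣ s) lam(da)`. -/
def Policy.kernel [SigmaFinite lam] (pol : Policy S lam) : Kernel S A :=
  Kernel.withDensity (Kernel.const S lam) (fun s a => ENNReal.ofReal (pol.dens s a))

instance Policy.isMarkovKernel_kernel [SigmaFinite lam] (pol : Policy S lam) :
    IsMarkovKernel pol.kernel := by
  refine ⟨fun s => ⟨?_⟩⟩
  have hm : Measurable (Function.uncurry fun s a => ENNReal.ofReal (pol.dens s a)) :=
    pol.measurable_dens.ennreal_ofReal
  rw [Policy.kernel, Kernel.withDensity_apply' _ hm]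
  simpa using pol.lintegral_dens s

/-- The joint law `p_S(ds) π(a ∣ s) lam(da) p_R(dr ∣ s, a)` of an observation made under `π`. -/
def obsLaw [SigmaFinite lam] (pS : Measure S) (pol : Policy S lam)
    (pR : Kernel (S × A) (Set.Icc (0 : ℝ) Rmax)) : Measure (Obs S A Rmax) :=
  (pS.compProd pol.kernel).compProd pR

/-- The value `J = E_π[r]` of a policy. -/
def policyValue [SigmaFinite lam] (pS : Measure S) (pol : Policy S lam)
    (pR : Kernel (S × A) (Set.Icc (0 : ℝ) Rmax)) : ℝ :=
  ∫ o, (o.2 : ℝ) ∂(obsLaw pS pol pR)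

variable {K : ℕ}

/-- The pooled sample size `n = n_1 + ... + n_K`. -/
def total (n : Fin K → ℕ) : ℕ := ∑ k, n k

/-- `Σ_k n_k π_k(a ∣ s) h(k,s,a) = n` for all `s, a` such that `π^e(a ∣ s) > 0`. -/
def WeightConstraint (n : Fin K → ℕ) (polL : Fin K → Policy S lam) (polE : Policy S lam)
    (h : Fin K → S → A → ℝ) : Prop :=
  ∀ s a, 0 < polE.dens s a → ∑ k, (n k : ℝ) * (polL k).dens s a * h k s a = (total n : ℝ)

/-- `‖f‖₂ = (E_{π_*}[f²])^{1/2}` where `E_{π_*} = Σ_k ρ_k E_{π_k}` with `ρ_k = n_k / n`, for a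
function `f(k,s,a)`. -/
def l2Norm [SigmaFinite lam] (n : Fin K → ℕ) (pS : Measure S) (polL : Fin K → Policy S lam)
    (pR : Kernel (S × A) (Set.Icc (0 : ℝ) Rmax)) (f : Fin K → S → A → ℝ) : ℝ :=
  √(∑ k, ((n k : ℝ) / (total n : ℝ)) * ∫ o, (f k o.1.1 o.1.2) ^ 2 ∂(obsLaw pS (polL k) pR))

/-- The summand `h(k,s,a) π^e(a ∣ s) (r - g(s,a)) + g(s,π^e)`, where
`g(s,π^e) = ∫ g(s,a) π^e(a ∣ s) lam(da)`. -/
def score (polE : Policy S lam) (h : Fin K → S → A → ℝ) (g : S → A → ℝ) (k : Fin K)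
    (o : Obs S A Rmax) : ℝ :=
  h k o.1.1 o.1.2 * polE.dens o.1.1 o.1.2 * ((o.2 : ℝ) - g o.1.1 o.1.2)
    + ∫ a, g o.1.1 a * polE.dens o.1.1 a ∂lam

/-- Stratified data: `N k` observations from logger `k`. -/
abbrev Sample (S A : Type*) (Rmax : ℝ) (N : Fin K → ℕ) : Type _ :=
  (k : Fin K) → Fin (N k) → Obs S A Rmax

/-- A set of observation indices in each stratum, representing a part of the data. -/
abbrev IndexSet (N : Fin K → ℕ) : Type := (k : Fin K) → Finset (Fin (N k))

/-- The number of observations in a part of the data. -/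
def partSize {N : Fin K → ℕ} (I : IndexSet N) : ℕ := ∑ k, (I k).card

/-- The part of the data with indices in `I`. -/
abbrev SubSample (S A : Type*) (Rmax : ℝ) {N : Fin K → ℕ} (I : IndexSet N) : Type _ :=
  (k : Fin K) → {j : Fin (N k) // j ∈ I k} → Obs S A Rmax

/-- Restriction of the data to the indices in `I`. -/
def restrict {N : Fin K → ℕ} (I : IndexSet N) (d : Sample S A Rmax N) : SubSample S A Rmax I :=
  fun k j => d k j.1

/-- `Γ(·; h, g)` evaluated on a part of the data: the average of the summands over that part. -/
def Gam (polE : Policy S lam) {N : Fin K → ℕ} (I : IndexSet N) (d : SubSample S A Rmax I)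
    (h : Fin K → S → A → ℝ) (g : S → A → ℝ) : ℝ :=
  (∑ k, ∑ j, score polE h g k (d k j)) / (partSize I : ℝ)

variable {Z : ℕ}

/-- An assignment of each observation index of each stratum to one of `Z` folds, that is, a
partition `(I_{kz})_z` of `{1, ..., N_k}` for every `k`. -/
abbrev FoldMap (N : Fin K → ℕ) (Z : ℕ) : Type := (k : Fin K) → Fin (N k) → Fin Z

/-- The indices `I_{kz}` of the `z`-th fold (those of `L_z`). -/
def foldIdx {N : Fin K → ℕ} (φ : FoldMap N Z) (z : Fin Z) : IndexSet N :=
  fun k => Finset.univ.filter fun j => φ k j = z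

/-- The indices outside the `z`-th fold (those of `U_z`). -/
def trainIdx {N : Fin K → ℕ} (φ : FoldMap N Z) (z : Fin Z) : IndexSet N :=
  fun k => Finset.univ.filter fun j => φ k j ≠ z

/-- Every `|I_{kz}|` is within `1` of `N_k / Z`. -/
def EvenFolds {N : Fin K → ℕ} (φ : FoldMap N Z) : Prop :=
  ∀ k z, |((foldIdx φ z k).card : ℝ) - (N k : ℝ) / (Z : ℝ)| ≤ 1

/-- Every fold contains the loggers in the proportions `n_k / n`:
`|I_{kz}| / |L_z| = n_k / n` (in product form). -/
def ProportionalFolds (n : Fin K → ℕ) {N : Fin K → ℕ} (φ : FoldMap N Z) : Prop :=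
  ∀ k z, (foldIdx φ z k).card * total n = n k * partSize (foldIdx φ z)

/-- Stratum sizes `n'_k = m n_k`. -/
abbrev scaled (n : Fin K → ℕ) (m : ℕ) : Fin K → ℕ := fun k => m * n k

/-- An estimator of a function of type `F`: it maps any part of the data, for any `m`, to
a function. -/
abbrev Estimator (S A : Type*) (Rmax : ℝ) (n : Fin K → ℕ) (F : Type*) : Type _ :=
  (m : ℕ) → (I : IndexSet (scaled n m)) → SubSample S A Rmax I → F

/-- The cross-fitted estimator `Ĵ_BI(ĥ, ĝ) = (1/n') Σ_z |L_z| Γ(L_z; ĥ(·; U_z), ĝ(·; U_z))`. -/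
def JBI (polE : Policy S lam) {n : Fin K → ℕ}
    (hhat : Estimator S A Rmax n (Fin K → S → A → ℝ)) (ghat : Estimator S A Rmax n (S → A → ℝ))
    (m : ℕ) (φ : FoldMap (scaled n m) Z) (d : Sample S A Rmax (scaled n m)) : ℝ :=
  (∑ z, (partSize (foldIdx φ z) : ℝ) *
    Gam polE (foldIdx φ z) (restrict (foldIdx φ z) d)
      (hhat m (trainIdx φ z) (restrict (trainIdx φ z) d))
      (ghat m (trainIdx φ z) (restrict (trainIdx φ z) d))) / (total (scaled n m) : ℝ)

/-- The first `N k` observations of each logger, out of infinite sequences of observations. -/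
def sampleOf {Ω : Type*} (X : Fin K → ℕ → Ω → Obs S A Rmax) (N : Fin K → ℕ) (ω : Ω) :
    Sample S A Rmax N :=
  fun k j => X k j ω

end MultiLogger

end

/-!
Write `ν k` for the law of an observation of logger `k`. All these laws have densities `π_k(a ∣ s)`
with respect to one σ-finite measure `baseLaw`, so the constraint on the weights gives, for any
bounded `h` and `g` that satisfy it, `Σ_k n_k E_k[score h g k] = n J` (`sum_mul_integral_score`).

With `Δ_z` the difference of the summands computed from the functions fitted outside the `z`-th fold
and from the true `h` and `g`, the estimator splits as (`JBI_eq`)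

`n' Ĵ = Σ_{k,j} score h g k (obs k j) + Σ_z T_z + b`,

where `T_z` is the sum over the `z`-th fold of `Δ_z`, centred at its mean given the other folds, and
`b` collects these means.

* The first term has mean `n' J`. Cutting the data into `m` blocks of `n_k` observations from each
  logger `k` turns it into a sum of `m` independent copies of `n Γ(D; h, g)`, and the classical
  central limit theorem applies (`tendstoInDistribution_stratified`).
* Given the folds and the data outside the `z`-th fold, the summands of `T_z` are independent and
  centred. Hence `T_z` has mean zero and its second moment is at most `Σ_k n'_k E[E_k[Δ_z²]]`
  (`crossSum_moments`).
* `Σ_k n_k E_k[Δ_z] = 0` by the identity above. So `b = 0` if the folds contain the loggers in exact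
  proportions (`foldBias_eq_zero`), and `b` is bounded if the folds are even, as the counts are then
  within `1` of exact proportions (`abs_foldBias_le`). This settles the two claims on the mean.

For the asymptotic normality it remains to see that `Σ_k n_k E_k[Δ_z²]` tends to zero in mean. It is
bounded, so convergence in probability suffices. By `strataSum_score_sub_le` it is at most a
constant times
`(1 + M²) (‖ĥ - h‖₂² + ‖ĝ - g‖₂²) + E_{π_*}[π^e(a ∣ s)² 1{π^e(a ∣ s) > M}]` for every `M`: the
factor `π^e(a ∣ s)` is truncated at `M`, and the term `∫ (ĝ - g) π^e`, a mean under the target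
policy, is compared with the loggers through `n ≤ C Σ_k n_k π_k(a ∣ s)`, which the constraint on `h`
implies. Then `(Σ_z T_z + b) / √n'` tends to zero in probability, and Slutsky's theorem concludes.
-/

noncomputable section

namespace MultiLogger

/-! ### The law of an observation -/

section Laws

variable {S A : Type*} [MeasurableSpace S] [MeasurableSpace A] {lam : Measure A} {Rmax : ℝ}

lemma withDensity_compProd {α β : Type*} [MeasurableSpace α] [MeasurableSpace β]
    (μ : Measure α) [SFinite μ] (κ : Kernel α β) [IsSFiniteKernel κ]
    {f : α → ENNReal} (hf : Measurable f) [SFinite (μ.withDensity f)] :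
    (μ.withDensity f).compProd κ = (μ.compProd κ).withDensity (fun p => f p.1) := by
  ext s hs
  rw [Measure.compProd_apply hs, withDensity_apply _ hs, ← lintegral_indicator hs,
    Measure.lintegral_compProd (f := s.indicator fun p => f p.1)
      ((hf.comp measurable_fst).indicator hs),
    lintegral_withDensity_eq_lintegral_mul _ hf (Kernel.measurable_kernel_prodMk_left hs)]
  congr with a
  have : (fun b => s.indicator (fun p : α × β => f p.1) (a, b))
      = (Prod.mk a ⁻¹' s).indicator (fun _ => f a) := by
    ext b; rfl
  rw [this, lintegral_indicator (measurable_prodMk_left hs)]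
  simp

instance isProbabilityMeasure_obsLaw [SigmaFinite lam] (pS : Measure S)
    [IsProbabilityMeasure pS] (pR : Kernel (S × A) (Set.Icc (0 : ℝ) Rmax)) [IsMarkovKernel pR]
    (pol : Policy S lam) : IsProbabilityMeasure (obsLaw pS pol pR) := by
  unfold obsLaw; infer_instance

lemma Policy.measurable_dens_obs (pol : Policy S lam) :
    Measurable fun o : Obs S A Rmax => pol.dens o.1.1 o.1.2 :=
  pol.measurable_dens.comp measurable_fst

lemma Policy.measurable_ofReal_dens (pol : Policy S lam) (s : S) :
    Measurable fun a => ENNReal.ofReal (pol.dens s a) :=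
  (pol.measurable_dens.comp measurable_prodMk_left).ennreal_ofReal

/-- The σ-finite measure `p_S(ds) lam(da) p_R(dr ∣ s, a)`, which dominates every `obsLaw`. -/
def baseLaw (lam : Measure A) (pS : Measure S) (pR : Kernel (S × A) (Set.Icc (0 : ℝ) Rmax)) :
    Measure (Obs S A Rmax) := (pS.prod lam).compProd pR

variable [SigmaFinite lam] {pS : Measure S} [IsProbabilityMeasure pS]
  {pR : Kernel (S × A) (Set.Icc (0 : ℝ) Rmax)} [IsMarkovKernel pR]

lemma obsLaw_eq_withDensity (pol : Policy S lam) :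
    obsLaw pS pol pR
      = (baseLaw lam pS pR).withDensity fun o => ENNReal.ofReal (pol.dens o.1.1 o.1.2) := by
  have hm : Measurable (Function.uncurry fun s a => ENNReal.ofReal (pol.dens s a)) :=
    pol.measurable_dens.ennreal_ofReal
  have hK : IsSFiniteKernel (Kernel.withDensity (Kernel.const S lam)
      (fun s a => ENNReal.ofReal (pol.dens s a))) :=
    inferInstanceAs (IsSFiniteKernel pol.kernel)
  have h1 : pS.compProd pol.kernel
      = (pS.prod lam).withDensity (fun p => ENNReal.ofReal (pol.dens p.1 p.2)) := by
    rw [Policy.kernel, Measure.compProd_withDensity hm, Measure.compProd_const]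
  have h2 : SFinite ((pS.prod lam).withDensity (fun p => ENNReal.ofReal (pol.dens p.1 p.2))) := by
    rw [← h1]; infer_instance
  exact (congrArg (·.compProd pR) h1).trans (withDensity_compProd _ _ hm)

lemma integral_obsLaw (pol : Policy S lam) (F : Obs S A Rmax → ℝ) :
    ∫ o, F o ∂(obsLaw pS pol pR) = ∫ o, pol.dens o.1.1 o.1.2 * F o ∂(baseLaw lam pS pR) := by
  rw [obsLaw_eq_withDensity, integral_withDensity_eq_integral_toReal_smul
    pol.measurable_dens_obs.ennreal_ofReal (by simp)]
  simp [pol.dens_nonneg]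

lemma integrable_obsLaw_iff (pol : Policy S lam) (F : Obs S A Rmax → ℝ) :
    Integrable F (obsLaw pS pol pR)
      ↔ Integrable (fun o => pol.dens o.1.1 o.1.2 * F o) (baseLaw lam pS pR) := by
  rw [obsLaw_eq_withDensity, integrable_withDensity_iff_integrable_smul'
    pol.measurable_dens_obs.ennreal_ofReal (by simp)]
  simp [pol.dens_nonneg]

lemma map_fst_obsLaw (pol : Policy S lam) :
    (obsLaw pS pol pR).map (fun o => o.1.1) = pS := by
  have : (fun o : Obs S A Rmax => o.1.1) = Prod.fst ∘ Prod.fst := rfl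
  rw [this, ← Measure.map_map measurable_fst measurable_fst]
  change ((obsLaw pS pol pR).fst).fst = pS
  rw [obsLaw, Measure.fst_compProd, Measure.fst_compProd]

lemma integral_obsLaw_context (pol : Policy S lam) {F : S → ℝ} (hF : Measurable F) :
    ∫ o, F o.1.1 ∂(obsLaw pS pol pR) = ∫ s, F s ∂pS := by
  conv_rhs => rw [← map_fst_obsLaw (pS := pS) (pR := pR) pol]
  rw [integral_map (by fun_prop) hF.aestronglyMeasurable]

lemma Policy.integral_kernel (pol : Policy S lam) (s : S) (f : A → ℝ) :
    ∫ a, f a ∂(pol.kernel s) = ∫ a, f a * pol.dens s a ∂lam := by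
  have hm : Measurable (Function.uncurry fun s a => ENNReal.ofReal (pol.dens s a)) :=
    pol.measurable_dens.ennreal_ofReal
  rw [Policy.kernel, Kernel.withDensity_apply _ hm, Kernel.const_apply,
    integral_withDensity_eq_integral_toReal_smul (pol.measurable_ofReal_dens s) (by simp)]
  simp [pol.dens_nonneg, mul_comm]

lemma integral_obsLaw_action (pol : Policy S lam) {F : S × A → ℝ} (hF : Measurable F)
    {C : ℝ} (hC : ∀ p, |F p| ≤ C) :
    ∫ o, F o.1 ∂(obsLaw pS pol pR) = ∫ s, ∫ a, F (s, a) * pol.dens s a ∂lam ∂pS := by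
  have h1 : ∫ o, F o.1 ∂(obsLaw pS pol pR) = ∫ p, F p ∂(pS.compProd pol.kernel) := by
    have : (obsLaw pS pol pR).map Prod.fst = pS.compProd pol.kernel := by
      change (obsLaw pS pol pR).fst = _
      rw [obsLaw, Measure.fst_compProd]
    rw [← this, integral_map (by fun_prop) hF.aestronglyMeasurable]
  rw [h1, Measure.integral_compProd
    (Integrable.of_bound hF.aestronglyMeasurable C (ae_of_all _ fun p => hC p))]
  simp_rw [pol.integral_kernel]

/-- Jensen: the square of a mean under a policy is at most the mean of the squares. -/
lemma Policy.sq_integral_dens_le (pol : Policy S lam) (s : S) {f : A → ℝ} (hf : Measurable f)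
    {C : ℝ} (hC : ∀ a, |f a| ≤ C) :
    (∫ a, f a * pol.dens s a ∂lam) ^ 2 ≤ ∫ a, f a ^ 2 * pol.dens s a ∂lam := by
  rw [← pol.integral_kernel s f, ← pol.integral_kernel s (fun a => f a ^ 2)]
  have h2 : MemLp f 2 (pol.kernel s) :=
    MemLp.of_bound hf.aestronglyMeasurable C (ae_of_all _ fun a => hC a)
  have := variance_nonneg f (pol.kernel s)
  rw [variance_eq_sub h2] at this
  simpa using this

lemma Policy.abs_integral_dens_le (pol : Policy S lam) (s : S) {f : A → ℝ}
    {C : ℝ} (hC : ∀ a, |f a| ≤ C) : |∫ a, f a * pol.dens s a ∂lam| ≤ C := by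
  rw [← pol.integral_kernel s f]
  simpa using norm_integral_le_of_norm_le_const (μ := pol.kernel s) (f := f)
    (ae_of_all _ fun a => hC a)

lemma Policy.integrable_mul_dens (pol : Policy S lam) (s : S) {f : A → ℝ} (hf : Measurable f)
    {C : ℝ} (hC : ∀ a, |f a| ≤ C) : Integrable (fun a => f a * pol.dens s a) lam := by
  have hm : Measurable (Function.uncurry fun s a => ENNReal.ofReal (pol.dens s a)) :=
    pol.measurable_dens.ennreal_ofReal
  have h : Integrable f (pol.kernel s) :=
    Integrable.of_bound hf.aestronglyMeasurable C (ae_of_all _ fun a => hC a)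
  rw [Policy.kernel, Kernel.withDensity_apply _ hm, Kernel.const_apply,
    integrable_withDensity_iff_integrable_smul' (pol.measurable_ofReal_dens s) (by simp)] at h
  simpa [pol.dens_nonneg, mul_comm] using h

end Laws

/-! ### The summands and their means -/

section Score

variable {S A : Type*} [MeasurableSpace S] [MeasurableSpace A] {lam : Measure A} {Rmax : ℝ}
  {K : ℕ}

lemma measurable_score [SFinite lam] (polE : Policy S lam) {T : Type*} [MeasurableSpace T]
    {h : T → Fin K → S → A → ℝ} {g : T → S → A → ℝ} (k : Fin K)
    (hh : Measurable fun p : T × S × A => h p.1 k p.2.1 p.2.2)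
    (hg : Measurable fun p : T × S × A => g p.1 p.2.1 p.2.2) :
    Measurable fun p : T × Obs S A Rmax => score polE (h p.1) (g p.1) k p.2 := by
  have hr : Measurable fun p : T × Obs S A Rmax => (p.1, p.2.1.1, p.2.1.2) := by fun_prop
  have h1 : Measurable fun p : T × Obs S A Rmax => h p.1 k p.2.1.1 p.2.1.2 := hh.comp hr
  have h2 : Measurable fun p : T × Obs S A Rmax => g p.1 p.2.1.1 p.2.1.2 := hg.comp hr
  have h3 : Measurable fun p : T × Obs S A Rmax => polE.dens p.2.1.1 p.2.1.2 :=
    polE.measurable_dens.comp (measurable_fst.comp measurable_snd)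
  have h4 : Measurable fun q : (T × S) × A => g q.1.1 q.1.2 q.2 * polE.dens q.1.2 q.2 := by
    have e1 : Measurable fun q : (T × S) × A => (q.1.1, q.1.2, q.2) := by fun_prop
    have e2 : Measurable fun q : (T × S) × A => (q.1.2, q.2) := by fun_prop
    exact (hg.comp e1).mul (polE.measurable_dens.comp e2)
  have h5 : Measurable fun q : T × S => ∫ a, g q.1 q.2 a * polE.dens q.2 a ∂lam :=
    (h4.stronglyMeasurable.integral_prod_right (ν := lam)).measurable
  have h6 : Measurable fun p : T × Obs S A Rmax =>
      ∫ a, g p.1 p.2.1.1 a * polE.dens p.2.1.1 a ∂lam := by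
    have e3 : Measurable fun p : T × Obs S A Rmax => (p.1, p.2.1.1) := by fun_prop
    exact h5.comp e3
  have h7 : Measurable fun p : T × Obs S A Rmax => (p.2.2 : ℝ) := by fun_prop
  exact ((h1.mul h3).mul (h7.sub h2)).add h6

lemma measurable_score_right [SFinite lam] (polE : Policy S lam)
    {h : Fin K → S → A → ℝ} {g : S → A → ℝ} (k : Fin K)
    (hh : Measurable (Function.uncurry (h k))) (hg : Measurable (Function.uncurry g)) :
    Measurable fun o : Obs S A Rmax => score polE h g k o := by
  have := measurable_score (Rmax := Rmax) polE (T := Unit) (h := fun _ => h) (g := fun _ => g) k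
    (hh.comp measurable_snd) (hg.comp measurable_snd)
  exact this.comp (measurable_prodMk_left (x := ()))

/-- The bound `C π^e(a ∣ s) (Rmax + C) + C` on the summand `score` for `h`, `g` bounded by `C`. -/
def envelope (polE : Policy S lam) (C : ℝ) (o : Obs S A Rmax) : ℝ :=
  C * (Rmax + C) * polE.dens o.1.1 o.1.2 + C

lemma WeightConstraint.ident {n : Fin K → ℕ} {polL : Fin K → Policy S lam} {polE : Policy S lam}
    {h : Fin K → S → A → ℝ} (hc : WeightConstraint n polL polE h) (s : S) (a : A) :
    (∑ k, (n k : ℝ) * (polL k).dens s a * h k s a) * polE.dens s a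
      = (total n : ℝ) * polE.dens s a := by
  rcases (polE.dens_nonneg s a).eq_or_lt with h0 | h0
  · simp [← h0]
  · rw [hc s a h0]

variable [SigmaFinite lam] {pS : Measure S} [IsProbabilityMeasure pS]
  {pR : Kernel (S × A) (Set.Icc (0 : ℝ) Rmax)} [IsMarkovKernel pR]

lemma abs_score_le (polE : Policy S lam) {C : ℝ} {h : Fin K → S → A → ℝ} {g : S → A → ℝ}
    {k : Fin K} (hh : ∀ s a, |h k s a| ≤ C) (hg : ∀ s a, |g s a| ≤ C) (o : Obs S A Rmax) :
    |score polE h g k o| ≤ envelope polE C o := by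
  have h1 := hh o.1.1 o.1.2
  have h0 : 0 ≤ C := (abs_nonneg _).trans h1
  have h2 := hg o.1.1 o.1.2
  have h3 : |(o.2 : ℝ) - g o.1.1 o.1.2| ≤ Rmax + C := by
    have a1 := o.2.2.1
    have a2 := o.2.2.2
    rw [abs_le] at h2 ⊢
    constructor <;> linarith
  have h4 := polE.abs_integral_dens_le o.1.1 (f := g o.1.1) (hg o.1.1)
  have h5 := polE.dens_nonneg o.1.1 o.1.2
  unfold score envelope
  refine (abs_add_le _ _).trans (add_le_add ?_ h4)
  rw [abs_mul, abs_mul, abs_of_nonneg h5]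
  calc _ ≤ C * polE.dens o.1.1 o.1.2 * (Rmax + C) := by gcongr
    _ = _ := by ring

lemma memLp_envelope (polE pol : Policy S lam) (C : ℝ)
    (hsq : Integrable (fun o : Obs S A Rmax => (polE.dens o.1.1 o.1.2) ^ 2) (obsLaw pS pol pR)) :
    MemLp (envelope (Rmax := Rmax) polE C) 2 (obsLaw pS pol pR) :=
  (((memLp_two_iff_integrable_sq polE.measurable_dens_obs.aestronglyMeasurable).2
    hsq).const_mul _).add (memLp_const C)

lemma memLp_score (polE pol : Policy S lam) {C : ℝ}
    (hsq : Integrable (fun o : Obs S A Rmax => (polE.dens o.1.1 o.1.2) ^ 2) (obsLaw pS pol pR))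
    {h : Fin K → S → A → ℝ} {g : S → A → ℝ} {k : Fin K}
    (hhm : Measurable (Function.uncurry (h k))) (hgm : Measurable (Function.uncurry g))
    (hh : ∀ s a, |h k s a| ≤ C) (hg : ∀ s a, |g s a| ≤ C) :
    MemLp (fun o : Obs S A Rmax => score polE h g k o) 2 (obsLaw pS pol pR) :=
  (memLp_envelope polE pol C hsq).of_le
    (measurable_score_right polE k hhm hgm).aestronglyMeasurable
    (ae_of_all _ fun o => (abs_score_le polE hh hg o).trans (le_abs_self _))

/-- Under the constraint on the weights, the summands have the right mean when the loggers are
averaged in the proportions `n_k / n`, whatever `h` and `g` are. -/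
lemma sum_mul_integral_score (n : Fin K → ℕ) (polL : Fin K → Policy S lam) (polE : Policy S lam)
    (hsq : ∀ k, 0 < n k → Integrable
      (fun o : Obs S A Rmax => (polE.dens o.1.1 o.1.2) ^ 2) (obsLaw pS (polL k) pR))
    {C : ℝ} {h : Fin K → S → A → ℝ} {g : S → A → ℝ}
    (hhm : ∀ k, Measurable (Function.uncurry (h k))) (hgm : Measurable (Function.uncurry g))
    (hh : ∀ k s a, |h k s a| ≤ C) (hg : ∀ s a, |g s a| ≤ C)
    (hc : WeightConstraint n polL polE h) :
    ∑ k, (n k : ℝ) * ∫ o, score polE h g k o ∂(obsLaw pS (polL k) pR)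
      = (total n : ℝ) * policyValue pS polE pR := by
  set Λ := baseLaw lam pS pR
  have hq : Measurable fun s => ∫ a, g s a * polE.dens s a ∂lam :=
    ((hgm.mul polE.measurable_dens).stronglyMeasurable.integral_prod_right (ν := lam)).measurable
  set q : ℝ := ∫ s, ∫ a, g s a * polE.dens s a ∂lam ∂pS with hq'
  set u : Fin K → Obs S A Rmax → ℝ := fun k o =>
    h k o.1.1 o.1.2 * polE.dens o.1.1 o.1.2 * ((o.2 : ℝ) - g o.1.1 o.1.2) with hu
  have hgo : Measurable fun o : Obs S A Rmax => g o.1.1 o.1.2 := hgm.comp measurable_fst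
  have hint2 : ∀ pol : Policy S lam, Integrable (fun o : Obs S A Rmax =>
      ∫ a, g o.1.1 a * polE.dens o.1.1 a ∂lam) (obsLaw pS pol pR) := fun pol =>
    Integrable.of_bound (hq.comp (measurable_fst.comp measurable_fst)).aestronglyMeasurable C
      (ae_of_all _ fun o => polE.abs_integral_dens_le _ (hg _))
  have hint1 : ∀ k, 0 < n k → Integrable (u k) (obsLaw pS (polL k) pR) := fun k hk => by
    have := ((memLp_score polE (polL k) (hsq k hk) (hhm k) hgm (hh k) hg).integrable
      (by norm_num)).sub (hint2 (polL k))
    refine this.congr (ae_of_all _ fun o => ?_)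
    simp [score, hu]
  have hk : ∀ k, (n k : ℝ) * ∫ o, score polE h g k o ∂(obsLaw pS (polL k) pR)
      = (∫ o, (n k : ℝ) * ((polL k).dens o.1.1 o.1.2 * u k o) ∂Λ) + n k * q := fun k => by
    rcases Nat.eq_zero_or_pos (n k) with h0 | h0
    · simp [h0]
    · have : ∫ o, score polE h g k o ∂(obsLaw pS (polL k) pR)
          = ∫ o, u k o ∂(obsLaw pS (polL k) pR) + q := by
        rw [hq', ← integral_obsLaw_context (pR := pR) (polL k) hq,
          ← integral_add (hint1 k h0) (hint2 _)]
        rfl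
      rw [this, mul_add, integral_const_mul, integral_obsLaw]
  rw [Finset.sum_congr rfl fun k _ => hk k, Finset.sum_add_distrib, ← integral_finsetSum,
    ← Finset.sum_mul]
  · have he : ∀ o : Obs S A Rmax, ∑ k, (n k : ℝ) * ((polL k).dens o.1.1 o.1.2 * u k o)
        = (total n : ℝ) * (polE.dens o.1.1 o.1.2 * ((o.2 : ℝ) - g o.1.1 o.1.2)) := fun o => by
      rw [← mul_assoc, ← hc.ident, Finset.sum_mul, Finset.sum_mul]
      exact Finset.sum_congr rfl fun k _ => by simp only [hu]; ring
    simp_rw [he]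
    rw [integral_const_mul, ← integral_obsLaw]
    have i1 : Integrable (fun o : Obs S A Rmax => (o.2 : ℝ)) (obsLaw pS polE pR) := by
      refine Integrable.of_bound (Measurable.aestronglyMeasurable (by fun_prop)) Rmax
        (ae_of_all _ fun o => ?_)
      rw [Real.norm_eq_abs, abs_of_nonneg o.2.2.1]; exact o.2.2.2
    have i2 : Integrable (fun o : Obs S A Rmax => g o.1.1 o.1.2) (obsLaw pS polE pR) :=
      Integrable.of_bound hgo.aestronglyMeasurable C (ae_of_all _ fun o => hg _ _)
    rw [integral_sub i1 i2]
    have : ∫ o, g o.1.1 o.1.2 ∂(obsLaw pS polE pR) = q :=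
      integral_obsLaw_action polE (F := fun p => g p.1 p.2) hgm (fun p => hg _ _)
    rw [this, policyValue, total]
    push_cast
    ring
  · intro k _
    rcases Nat.eq_zero_or_pos (n k) with h0 | h0
    · simp [h0]
    · exact ((integrable_obsLaw_iff _ _).1 (hint1 k h0)).const_mul _

end Score

/-! ### Sums that are centred given independent data -/

section Independence

variable {Ω β E : Type*} [MeasurableSpace Ω] [MeasurableSpace β] [MeasurableSpace E]
  {P : Measure Ω} [IsProbabilityMeasure P]

lemma integral_prod_of_indepFun {W : Ω → β} {Y : Ω → E} (hW : Measurable W)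
    (hY : Measurable Y) (hind : IndepFun W Y P) {F : β × E → ℝ} (hF : Measurable F)
    (hint : Integrable (fun ω => F (W ω, Y ω)) P) :
    ∫ ω, F (W ω, Y ω) ∂P = ∫ ω, ∫ x, F (W ω, x) ∂(P.map Y) ∂P := by
  have hmap := hind.map_prod_eq_prod_map_map hW.aemeasurable hY.aemeasurable
  have hWY : Measurable fun ω => (W ω, Y ω) := hW.prodMk hY
  have hpW : IsProbabilityMeasure (P.map W) := Measure.isProbabilityMeasure_map hW.aemeasurable
  have hpY : IsProbabilityMeasure (P.map Y) := Measure.isProbabilityMeasure_map hY.aemeasurable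
  have hint' : Integrable F ((P.map W).prod (P.map Y)) := by
    rw [← hmap]
    exact (integrable_map_measure hF.aestronglyMeasurable hWY.aemeasurable).2 hint
  have h1 : ∫ ω, F (W ω, Y ω) ∂P = ∫ p, F p ∂(P.map fun ω => (W ω, Y ω)) :=
    (integral_map hWY.aemeasurable hF.aestronglyMeasurable).symm
  rw [h1, hmap, integral_prod _ hint', integral_map hW.aemeasurable
    hF.stronglyMeasurable.integral_prod_right'.aestronglyMeasurable]

variable {ι : Type*} {X : ι → Ω → E}

/-- If every summand `f p (W, X p)` is centred given `W`, and `W` is a function of observations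
other than those summed over, then the summands are centred and uncorrelated. -/
lemma integral_centred_sum [DecidableEq ι] (hX : ∀ p, Measurable (X p)) (hind : iIndepFun X P)
    (I U : Finset ι) (hIU : Disjoint U I) {w : (U → E) → β} (hw : Measurable w)
    {f : ι → β × E → ℝ} (hf : ∀ p ∈ I, Measurable (f p))
    (hcent : ∀ p ∈ I, ∀ b, ∫ x, f p (b, x) ∂(P.map (X p)) = 0)
    (hL2 : ∀ p ∈ I, MemLp (fun ω => f p (w (fun i => X i ω), X p ω)) 2 P) :
    ∫ ω, ∑ p ∈ I, f p (w (fun i => X i ω), X p ω) ∂P = 0 ∧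
    ∫ ω, (∑ p ∈ I, f p (w (fun i => X i ω), X p ω)) ^ 2 ∂P
      = ∑ p ∈ I, ∫ ω, ∫ x, (f p (w (fun i => X i ω), x)) ^ 2 ∂(P.map (X p)) ∂P := by
  set W : Ω → β := fun ω => w (fun i => X i ω)
  have hWm : Measurable W := hw.comp (measurable_pi_lambda _ fun i => hX i)
  -- the conditioning variable, alone or with a second summand, is independent of `X p`
  have hind2 : ∀ p ∈ I, ∀ q, q ≠ p → IndepFun (fun ω => (W ω, X q ω)) (X p) P := by
    intro p hp q hqp
    have hd : Disjoint (insert q U) {p} := by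
      rw [Finset.disjoint_singleton_right, Finset.mem_insert, not_or]
      exact ⟨hqp.symm, fun h => (Finset.disjoint_left.1 hIU h) hp⟩
    have h1 := hind.indepFun_finset _ _ hd hX
    have m1 : Measurable fun x : (↥(insert q U) → E) =>
        (w (fun i : U => x ⟨i.1, Finset.mem_insert_of_mem i.2⟩),
          x ⟨q, Finset.mem_insert_self q U⟩) := by
      refine Measurable.prodMk (hw.comp ?_) (measurable_pi_apply _)
      exact measurable_pi_lambda _ fun i => measurable_pi_apply _
    have m2 : Measurable fun x : (↥({p} : Finset ι) → E) => x ⟨p, Finset.mem_singleton_self p⟩ :=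
      measurable_pi_apply _
    exact h1.comp m1 m2
  have hind1 : ∀ p ∈ I, IndepFun W (X p) P := by
    intro p hp
    have hd : Disjoint U {p} := by
      rw [Finset.disjoint_singleton_right]
      exact fun h => (Finset.disjoint_left.1 hIU h) hp
    have h1 := hind.indepFun_finset _ _ hd hX
    have m2 : Measurable fun x : (↥({p} : Finset ι) → E) => x ⟨p, Finset.mem_singleton_self p⟩ :=
      measurable_pi_apply _
    exact h1.comp hw m2
  constructor
  · rw [integral_finsetSum _ fun p hp => (hL2 p hp).integrable (by norm_num)]
    refine Finset.sum_eq_zero fun p hp => ?_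
    rw [integral_prod_of_indepFun hWm (hX p) (hind1 p hp) (hf p hp)
      ((hL2 p hp).integrable (by norm_num))]
    simp [hcent p hp]
  · have hmul : ∀ p ∈ I, ∀ q ∈ I,
        Integrable (fun ω => f p (W ω, X p ω) * f q (W ω, X q ω)) P := fun p hp q hq =>
      (hL2 p hp).integrable_mul (hL2 q hq)
    simp_rw [sq (∑ p ∈ I, _), Finset.sum_mul_sum]
    rw [integral_finsetSum _ fun p hp => integrable_finsetSum _ fun q hq => hmul p hp q hq]
    refine Finset.sum_congr rfl fun p hp => ?_
    rw [integral_finsetSum _ fun q hq => hmul p hp q hq, Finset.sum_eq_single_of_mem p hp]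
    · rw [← integral_prod_of_indepFun (F := fun z => f p z ^ 2) hWm (hX p) (hind1 p hp)
        ((hf p hp).pow_const 2) (hL2 p hp).integrable_sq]
      simp_rw [sq]
    · intro q hq hqp
      have hm : Measurable fun z : (β × E) × E => f p (z.1.1, z.2) * f q z.1 :=
        ((hf p hp).comp (by fun_prop)).mul ((hf q hq).comp measurable_fst)
      rw [integral_prod_of_indepFun (W := fun ω => (W ω, X q ω))
        (F := fun z => f p (z.1.1, z.2) * f q z.1) (hWm.prodMk (hX q)) (hX p) (hind2 p hp q hqp) hm
        (hmul p hp q hq)]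
      simp [integral_mul_const, hcent p hp]

end Independence

/-! ### Cross-fitted sums for fixed folds -/

section CrossFit

variable {S A : Type*} [MeasurableSpace S] [MeasurableSpace A] {Rmax : ℝ} {K Z : ℕ}
  {N : Fin K → ℕ}

/-- A function of an observation that is fitted on the part of the data outside the `z`-th fold,
for every assignment of folds. -/
abbrev Fitted (S A : Type*) (Rmax : ℝ) (N : Fin K → ℕ) (Z : ℕ) (z : Fin Z) : Type _ :=
  (φ : FoldMap N Z) → SubSample S A Rmax (trainIdx φ z) → Fin K → Obs S A Rmax → ℝ

/-- The sum over the `z`-th fold of a fitted function, each summand centred at its mean under the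
law of the observation. -/
def crossSum (ν : Fin K → Measure (Obs S A Rmax)) {z : Fin Z} (e : Fitted S A Rmax N Z z)
    (φ : FoldMap N Z) (d : Sample S A Rmax N) : ℝ :=
  ∑ k, ∑ j ∈ foldIdx φ z k, (e φ (restrict _ d) k (d k j) - ∫ o, e φ (restrict _ d) k o ∂(ν k))

lemma measurable_restrict (I : IndexSet N) :
    Measurable (restrict I : Sample S A Rmax N → SubSample S A Rmax I) := by
  unfold restrict
  fun_prop

lemma measurable_integral_fitted {ν : Fin K → Measure (Obs S A Rmax)}
    [∀ k, IsProbabilityMeasure (ν k)] {z : Fin Z} {e : Fitted S A Rmax N Z z}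
    (hem : ∀ φ k, Measurable fun p : SubSample S A Rmax (trainIdx φ z) × Obs S A Rmax =>
      e φ p.1 k p.2) (φ : FoldMap N Z) (k : Fin K) :
    Measurable fun u => ∫ o, e φ u k o ∂(ν k) :=
  ((hem φ k).stronglyMeasurable.integral_prod_right (ν := ν k)
    (f := fun u o => e φ u k o)).measurable

lemma measurable_crossSum {ν : Fin K → Measure (Obs S A Rmax)}
    [∀ k, IsProbabilityMeasure (ν k)] {z : Fin Z} {e : Fitted S A Rmax N Z z}
    (hem : ∀ φ k, Measurable fun p : SubSample S A Rmax (trainIdx φ z) × Obs S A Rmax =>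
      e φ p.1 k p.2) (φ : FoldMap N Z) : Measurable (crossSum ν e φ) := by
  unfold crossSum
  refine Finset.measurable_fun_sum _ fun k _ => Finset.measurable_fun_sum _ fun j _ => ?_
  have h1 := measurable_restrict (S := S) (A := A) (Rmax := Rmax) (trainIdx φ z)
  refine Measurable.sub ((hem φ k).comp (h1.prodMk (by fun_prop))) ?_
  exact (measurable_integral_fitted hem φ k).comp h1

/-- The indices of the observations in a stratified sample. -/
abbrev SampleIndex (N : Fin K → ℕ) : Type := Σ k : Fin K, Fin (N k)

variable {Ω : Type*} [MeasurableSpace Ω] {P : Measure Ω} [IsProbabilityMeasure P]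
  {X : Fin K → ℕ → Ω → Obs S A Rmax} {ν : Fin K → Measure (Obs S A Rmax)}

/-- For a fixed assignment of folds, the centred sum over a fold has mean zero, and its second
moment is at most the sum of those of its summands. -/
lemma crossSum_moments_of_fixed [∀ k, IsProbabilityMeasure (ν k)]
    (hXm : ∀ k j, Measurable (X k j)) (hXlaw : ∀ k j, P.map (X k j) = ν k)
    (hXindep : iIndepFun (fun p : Fin K × ℕ => X p.1 p.2) P)
    {z : Fin Z} {e : Fitted S A Rmax N Z z}
    (hem : ∀ φ k, Measurable fun p : SubSample S A Rmax (trainIdx φ z) × Obs S A Rmax =>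
      e φ p.1 k p.2)
    {G : Fin K → Obs S A Rmax → ℝ} (hG : ∀ k, 0 < N k → MemLp (G k) 2 (ν k))
    (φ : FoldMap N Z) (he : ∀ u k o, |e φ u k o| ≤ G k o) :
    MemLp (fun ω => crossSum ν e φ (sampleOf X N ω)) 2 P ∧
    ∫ ω, crossSum ν e φ (sampleOf X N ω) ∂P = 0 ∧
    ∫ ω, (crossSum ν e φ (sampleOf X N ω)) ^ 2 ∂P
      ≤ ∫ ω, ∑ k, (N k : ℝ) *
          ∫ o, (e φ (restrict _ (sampleOf X N ω)) k o) ^ 2 ∂(ν k) ∂P := by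
  classical
  set I : Finset (SampleIndex N) := Finset.univ.sigma (foldIdx φ z) with hI
  set U : Finset (SampleIndex N) := Finset.univ.sigma (trainIdx φ z)
  have hIU : Disjoint U I := by
    rw [Finset.disjoint_left]
    intro p hp hp'
    exact (Finset.mem_filter.1 (Finset.mem_sigma.1 hp).2).2
      (Finset.mem_filter.1 (Finset.mem_sigma.1 hp').2).2
  set X' : SampleIndex N → Ω → Obs S A Rmax := fun p => X p.1 p.2 with hX'
  have hX'm : ∀ p, Measurable (X' p) := fun p => hXm _ _
  have hind : iIndepFun X' P := by
    refine hXindep.precomp (g := fun p : SampleIndex N => ((p.1, (p.2 : ℕ)) : Fin K × ℕ)) ?_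
    rintro ⟨k, j⟩ ⟨k', j'⟩ h
    simp only [Prod.mk.injEq] at h
    obtain ⟨rfl, h2⟩ := h
    rw [Fin.ext h2]
  set w : (U → Obs S A Rmax) → SubSample S A Rmax (trainIdx φ z) :=
    fun x k j => x ⟨⟨k, j.1⟩, Finset.mem_sigma.2 ⟨Finset.mem_univ _, j.2⟩⟩
  have hwm : Measurable w := by
    refine measurable_pi_lambda _ fun k => measurable_pi_lambda _ fun j => measurable_pi_apply _
  have hGpos : ∀ p : SampleIndex N, 0 < N p.1 := fun p => (Nat.zero_le _).trans_lt p.2.2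
  have hint : ∀ (p : SampleIndex N) u, MemLp (fun o => e φ u p.1 o) 2 (ν p.1) := fun p u =>
    (hG p.1 (hGpos p)).of_le ((hem φ p.1).comp measurable_prodMk_left).aestronglyMeasurable
      (ae_of_all _ fun o => (he u p.1 o).trans (le_abs_self _))
  set f : SampleIndex N → SubSample S A Rmax (trainIdx φ z) × Obs S A Rmax → ℝ := fun p y =>
    e φ y.1 p.1 y.2 - ∫ o, e φ y.1 p.1 o ∂(ν p.1) with hf
  have hfm : ∀ p, Measurable (f p) := fun p =>
    (hem φ p.1).sub ((measurable_integral_fitted hem φ p.1).comp measurable_fst)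
  have hcent : ∀ p ∈ I, ∀ b, ∫ x, f p (b, x) ∂(P.map (X' p)) = 0 := by
    intro p _ b
    rw [hX', hXlaw]
    simp only [hf]
    rw [integral_sub ((hint p b).integrable (by norm_num)) (integrable_const _)]
    simp
  have hbd : ∀ p y, |f p y| ≤ G p.1 y.2 + ∫ o, G p.1 o ∂(ν p.1) := by
    intro p y
    refine (abs_sub _ _).trans (add_le_add (he _ _ _) ?_)
    refine (abs_integral_le_integral_abs).trans ?_
    exact integral_mono ((hint p y.1).integrable (by norm_num)).abs
      ((hG p.1 (hGpos p)).integrable (by norm_num)) (fun o => he _ _ _)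
  have hL2 : ∀ p ∈ I, MemLp (fun ω => f p (w (fun i => X' i ω), X' p ω)) 2 P := by
    intro p _
    have hGX : MemLp (fun ω => G p.1 (X' p ω)) 2 P := by
      have h0 := hG p.1 (hGpos p)
      rw [← hXlaw p.1 p.2] at h0
      exact h0.comp_of_map (hXm _ _).aemeasurable
    refine (hGX.add (memLp_const (∫ o, G p.1 o ∂(ν p.1)))).of_le ?_
      (ae_of_all _ fun ω => (hbd p _).trans (le_abs_self _))
    exact ((hfm p).comp ((hwm.comp (measurable_pi_lambda _ fun i => hX'm i)).prodMk
      (hX'm p))).aestronglyMeasurable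
  have key := integral_centred_sum hX'm hind I U hIU hwm (fun p _ => hfm p) hcent hL2
  have hsum : ∀ ω, crossSum ν e φ (sampleOf X N ω)
      = ∑ p ∈ I, f p (w (fun i => X' i ω), X' p ω) := fun ω => by
    rw [hI, Finset.sum_sigma]
    rfl
  simp_rw [hsum]
  refine ⟨memLp_finsetSum _ hL2, key.1, key.2.le.trans ?_⟩
  have hvar : ∀ (p : SampleIndex N) u, ∫ x, (f p (u, x)) ^ 2 ∂(ν p.1)
      ≤ ∫ x, (e φ u p.1 x) ^ 2 ∂(ν p.1) := by
    intro p u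
    have := variance_le_expectation_sq (μ := ν p.1) (X := fun o => e φ u p.1 o)
      (hint p u).aestronglyMeasurable
    rwa [variance_eq_integral (hint p u).aemeasurable] at this
  have hsqG : ∀ (p : SampleIndex N) u, ∫ x, (e φ u p.1 x) ^ 2 ∂(ν p.1)
      ≤ ∫ x, (G p.1 x) ^ 2 ∂(ν p.1) := by
    intro p u
    refine integral_mono (hint p u).integrable_sq (hG p.1 (hGpos p)).integrable_sq fun o => ?_
    exact sq_le_sq' (by linarith [(abs_le.1 (he u p.1 o)).1]) (abs_le.1 (he u p.1 o)).2
  have hWm : Measurable fun ω => w (fun i => X' i ω) :=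
    hwm.comp (measurable_pi_lambda _ fun i => hX'm i)
  have hem2 : ∀ φ k, Measurable fun p : SubSample S A Rmax (trainIdx φ z) × Obs S A Rmax =>
      (e φ p.1 k p.2) ^ 2 :=
    fun φ k => (hem φ k).pow_const 2
  have hi1 : ∀ p : SampleIndex N, Integrable (fun ω =>
      ∫ x, (e φ (w (fun i => X' i ω)) p.1 x) ^ 2 ∂(ν p.1)) P := fun p => by
    refine Integrable.of_bound
      ((measurable_integral_fitted (ν := ν)
        (e := fun φ u k o => (e φ u k o) ^ 2) hem2 φ p.1).comp hWm).aestronglyMeasurable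
      (∫ x, (G p.1 x) ^ 2 ∂(ν p.1)) (ae_of_all _ fun ω => ?_)
    rw [Real.norm_eq_abs, abs_of_nonneg (integral_nonneg fun _ => sq_nonneg _)]
    exact hsqG p _
  calc ∑ p ∈ I, ∫ ω, ∫ x, (f p (w (fun i => X' i ω), x)) ^ 2 ∂(P.map (X' p)) ∂P
      ≤ ∑ p ∈ I, ∫ ω, ∫ x, (e φ (w (fun i => X' i ω)) p.1 x) ^ 2 ∂(ν p.1) ∂P := by
        refine Finset.sum_le_sum fun p _ => integral_mono_of_nonneg
          (ae_of_all _ fun ω => integral_nonneg fun _ => sq_nonneg _) (hi1 p)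
          (ae_of_all _ fun ω => ?_)
        simp only [hX', hXlaw]
        exact hvar p _
    _ ≤ ∑ p : SampleIndex N, ∫ ω, ∫ x, (e φ (w (fun i => X' i ω)) p.1 x) ^ 2 ∂(ν p.1) ∂P :=
        Finset.sum_le_sum_of_subset_of_nonneg (Finset.subset_univ _) fun p _ _ =>
          integral_nonneg fun _ => integral_nonneg fun _ => sq_nonneg _
    _ = ∫ ω, ∑ k, (N k : ℝ) *
          ∫ o, (e φ (restrict _ (sampleOf X N ω)) k o) ^ 2 ∂(ν k) ∂P := by
        rw [← integral_finsetSum _ fun p _ => hi1 p]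
        refine integral_congr_ae (ae_of_all _ fun ω => ?_)
        simp only [Fintype.sum_sigma, Finset.sum_const, Finset.card_univ, Fintype.card_fin,
          nsmul_eq_mul]
        rfl

end CrossFit

/-! ### Cross-fitted sums for random folds -/

section RandomFolds

variable {S A : Type*} [MeasurableSpace S] [MeasurableSpace A] {Rmax : ℝ} {K Z : ℕ}
  {N : Fin K → ℕ}
  {Ω : Type*} [MeasurableSpace Ω] {P : Measure Ω} [IsProbabilityMeasure P]
  {X : Fin K → ℕ → Ω → Obs S A Rmax} {fold : Ω → FoldMap N Z}

omit [IsProbabilityMeasure P] in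
lemma measurable_apply_fold_sample (hXm : ∀ k j, Measurable (X k j)) (hfold : Measurable fold)
    {F : FoldMap N Z → Sample S A Rmax N → ℝ} (hF : ∀ φ, Measurable (F φ)) :
    Measurable fun ω => F (fold ω) (sampleOf X N ω) := by
  have h1 : Measurable fun p : FoldMap N Z × Sample S A Rmax N => F p.1 p.2 :=
    measurable_from_prod_countable_right hF
  have h2 : Measurable fun ω => sampleOf X N ω := by
    unfold sampleOf
    fun_prop
  exact h1.comp (hfold.prodMk h2)

/-- As the folds are independent of the data, one may average over the data first. -/
lemma integral_fold_sample (hXm : ∀ k j, Measurable (X k j)) (hfold : Measurable fold)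
    (hind : IndepFun fold (fun ω (p : Fin K × ℕ) => X p.1 p.2 ω) P)
    {F : FoldMap N Z → Sample S A Rmax N → ℝ} (hF : ∀ φ, Measurable (F φ))
    (hint : Integrable (fun ω => F (fold ω) (sampleOf X N ω)) P) :
    ∫ ω, F (fold ω) (sampleOf X N ω) ∂P = ∫ ω, ∫ ω', F (fold ω) (sampleOf X N ω') ∂P ∂P := by
  set Y : Ω → (Fin K × ℕ) → Obs S A Rmax := fun ω p => X p.1 p.2 ω
  have hYm : Measurable Y := measurable_pi_lambda _ fun p => hXm _ _
  set T : ((Fin K × ℕ) → Obs S A Rmax) → Sample S A Rmax N := fun y k j => y (k, j) with hT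
  have hTm : Measurable T := by rw [hT]; fun_prop
  have hm : Measurable fun p : FoldMap N Z × ((Fin K × ℕ) → Obs S A Rmax) => F p.1 (T p.2) :=
    measurable_from_prod_countable_right fun φ => (hF φ).comp hTm
  have := integral_prod_of_indepFun hfold hYm hind hm hint
  refine this.trans (integral_congr_ae (ae_of_all _ fun ω => ?_))
  exact integral_map (f := fun y => F (fold ω) (T y)) hYm.aemeasurable
    ((hF _).comp hTm).aestronglyMeasurable

/-- For folds drawn independently of the data, the centred sum over a fold has mean zero, and its
second moment is at most the sum of those of its summands. The bound on the fitted functions is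
required only for the folds that can occur. -/
lemma crossSum_moments {ν : Fin K → Measure (Obs S A Rmax)} [∀ k, IsProbabilityMeasure (ν k)]
    (hXm : ∀ k j, Measurable (X k j)) (hXlaw : ∀ k j, P.map (X k j) = ν k)
    (hXindep : iIndepFun (fun p : Fin K × ℕ => X p.1 p.2) P)
    (hfold : Measurable fold)
    (hind : IndepFun fold (fun ω (p : Fin K × ℕ) => X p.1 p.2 ω) P)
    {Q : FoldMap N Z → Prop} (hQ : ∀ᵐ ω ∂P, Q (fold ω))
    {z : Fin Z} {e : Fitted S A Rmax N Z z}
    (hem : ∀ φ k, Measurable fun p : SubSample S A Rmax (trainIdx φ z) × Obs S A Rmax =>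
      e φ p.1 k p.2)
    {G : Fin K → Obs S A Rmax → ℝ} (hG : ∀ k, 0 < N k → MemLp (G k) 2 (ν k))
    (he : ∀ φ, Q φ → ∀ u k o, |e φ u k o| ≤ G k o) :
    MemLp (fun ω => crossSum ν e (fold ω) (sampleOf X N ω)) 2 P ∧
    ∫ ω, crossSum ν e (fold ω) (sampleOf X N ω) ∂P = 0 ∧
    ∫ ω, (crossSum ν e (fold ω) (sampleOf X N ω)) ^ 2 ∂P
      ≤ ∫ ω, ∑ k, (N k : ℝ) *
          ∫ o, (e (fold ω) (restrict _ (sampleOf X N ω)) k o) ^ 2 ∂(ν k) ∂P := by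
  classical
  have hfix := fun φ (hφ : Q φ) =>
    crossSum_moments_of_fixed (P := P) (X := X) (ν := ν) hXm hXlaw hXindep hem hG φ (he φ hφ)
  have hcm : ∀ φ, Measurable (crossSum ν e φ) := measurable_crossSum hem
  have hL2 : MemLp (fun ω => crossSum ν e (fold ω) (sampleOf X N ω)) 2 P := by
    have hdom : MemLp (fun ω => ∑ φ ∈ Finset.univ.filter Q,
        |crossSum ν e φ (sampleOf X N ω)|) 2 P :=
      memLp_finsetSum _ fun φ hφ => (hfix φ (Finset.mem_filter.1 hφ).2).1.abs
    refine hdom.of_le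
      (measurable_apply_fold_sample hXm hfold hcm).aestronglyMeasurable ?_
    filter_upwards [hQ] with ω hω
    refine le_trans ?_ (le_abs_self _)
    exact Finset.single_le_sum (f := fun φ => |crossSum ν e φ (sampleOf X N ω)|)
      (fun φ _ => abs_nonneg _) (Finset.mem_filter.2 ⟨Finset.mem_univ _, hω⟩)
  set V : FoldMap N Z → Sample S A Rmax N → ℝ := fun φ d =>
    ∑ k, (N k : ℝ) * ∫ o, (e φ (restrict _ d) k o) ^ 2 ∂(ν k)
  have hVm : ∀ φ, Measurable (V φ) := fun φ => by
    refine Finset.measurable_fun_sum _ fun k _ => Measurable.const_mul ?_ _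
    exact (measurable_integral_fitted (ν := ν) (e := fun φ u k o => (e φ u k o) ^ 2)
      (fun φ k => (hem φ k).pow_const 2) φ k).comp (measurable_restrict _)
  have hV0 : ∀ φ d, 0 ≤ V φ d := fun φ d => Finset.sum_nonneg fun k _ =>
    mul_nonneg (Nat.cast_nonneg _) (integral_nonneg fun _ => sq_nonneg _)
  have hVb : ∀ φ, Q φ → ∀ d, V φ d ≤ ∑ k, (N k : ℝ) * ∫ o, (G k o) ^ 2 ∂(ν k) := by
    intro φ hφ d
    refine Finset.sum_le_sum fun k _ => ?_
    rcases Nat.eq_zero_or_pos (N k) with h0 | h0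
    · simp [h0]
    · refine mul_le_mul_of_nonneg_left ?_ (Nat.cast_nonneg _)
      refine integral_mono_of_nonneg (ae_of_all _ fun _ => sq_nonneg _) (hG k h0).integrable_sq
        (ae_of_all _ fun o => ?_)
      have := abs_le.1 (he φ hφ (restrict _ d) k o)
      exact sq_le_sq' (by linarith [this.1]) this.2
  have hVi : Integrable (fun ω => V (fold ω) (sampleOf X N ω)) P := by
    refine Integrable.of_bound
      (measurable_apply_fold_sample hXm hfold hVm).aestronglyMeasurable
      (∑ k, (N k : ℝ) * ∫ o, (G k o) ^ 2 ∂(ν k)) ?_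
    filter_upwards [hQ] with ω hω
    rw [Real.norm_eq_abs, abs_of_nonneg (hV0 _ _)]
    exact hVb _ hω _
  refine ⟨hL2, ?_, ?_⟩
  · rw [integral_fold_sample hXm hfold hind hcm (hL2.integrable (by norm_num))]
    refine integral_eq_zero_of_ae ?_
    filter_upwards [hQ] with ω hω using (hfix _ hω).2.1
  · rw [integral_fold_sample (F := fun φ d => crossSum ν e φ d ^ 2) hXm hfold hind
      (fun φ => (hcm φ).pow_const 2) hL2.integrable_sq]
    change _ ≤ ∫ ω, V (fold ω) (sampleOf X N ω) ∂P
    rw [integral_fold_sample hXm hfold hind hVm hVi]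
    refine integral_mono_of_nonneg
      (ae_of_all _ fun ω => integral_nonneg fun _ => sq_nonneg _) ?_ ?_
    · refine Integrable.of_bound (Measurable.aestronglyMeasurable ?_)
        (∑ k, (N k : ℝ) * ∫ o, (G k o) ^ 2 ∂(ν k)) ?_
      · exact (measurable_of_countable fun φ => ∫ ω', V φ (sampleOf X N ω') ∂P).comp hfold
      · filter_upwards [hQ] with ω hω
        rw [Real.norm_eq_abs, abs_of_nonneg (integral_nonneg fun _ => hV0 _ _)]
        refine (integral_mono_of_nonneg (ae_of_all _ fun _ => hV0 _ _) (integrable_const _)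
          (ae_of_all _ fun ω' => hVb _ hω (sampleOf X N ω'))).trans ?_
        simp
    · filter_upwards [hQ] with ω hω using (hfix _ hω).2.2

end RandomFolds

/-! ### The central limit theorem for stratified samples -/

section BlockCLT

variable {S A : Type*} [MeasurableSpace S] [MeasurableSpace A] {Rmax : ℝ} {K : ℕ}
  {Ω : Type*} [MeasurableSpace Ω] {P : Measure Ω} [IsProbabilityMeasure P]
  {X : Fin K → ℕ → Ω → Obs S A Rmax}

/-- Rows of an array of independent variables are independent. -/
lemma iIndepFun_rows {ι κ E : Type*} [MeasurableSpace E]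
    {Y : ι × κ → Ω → E} (hY : ∀ p, Measurable (Y p)) (hind : iIndepFun Y P) :
    iIndepFun (fun i ω j => Y (i, j) ω) P := by
  have hp : ∀ i j, IsProbabilityMeasure (P.map (Y (i, j))) := fun i j =>
    Measure.isProbabilityMeasure_map (hY _).aemeasurable
  have hp' : ∀ p, IsProbabilityMeasure (P.map (Y p)) := fun p => hp p.1 p.2
  have hrow : ∀ i, P.map (fun ω j => Y (i, j) ω) = Measure.infinitePi fun j => P.map (Y (i, j)) :=
    fun i => (hind.precomp (g := fun j => (i, j)) fun a b h => (Prod.mk.inj h).2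
      ).map_fun_eq_infinitePi_map fun j => hY _
  rw [iIndepFun_iff_map_fun_eq_infinitePi_map (fun i => measurable_pi_lambda _ fun j => hY _)]
  simp_rw [hrow]
  rw [← Measure.infinitePi_map_curry (fun i j => P.map (Y (i, j))),
    ← hind.map_fun_eq_infinitePi_map hY, Measure.map_map (by fun_prop)
      (measurable_pi_lambda _ fun p => hY p)]
  rfl

/-- The `i`-th block of `n k` observations of each logger. -/
def block (X : Fin K → ℕ → Ω → Obs S A Rmax) (n : Fin K → ℕ) (i : ℕ) (ω : Ω) :
    Sample S A Rmax n :=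
  fun k j => X k (i * n k + j) ω

lemma sum_range_mul_eq {M : Type*} [AddCommMonoid M] (f : ℕ → M) (m r : ℕ) :
    ∑ i ∈ Finset.range m, ∑ j : Fin r, f (i * r + j) = ∑ j : Fin (m * r), f j := by
  rw [Fin.sum_univ_eq_sum_range]
  induction m with
  | zero => simp
  | succ m ih =>
    rw [Finset.sum_range_succ, ih, Nat.succ_mul, Finset.sum_range_add,
      Fin.sum_univ_eq_sum_range (fun j => f (m * r + j))]

/-- Disjoint blocks of observations are independent and identically distributed, and hence so are
the values of a function at them. -/
lemma block_iIndepFun_identDistrib (n : Fin K → ℕ) (ν : Fin K → Measure (Obs S A Rmax))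
    (hXm : ∀ k j, Measurable (X k j)) (hXlaw : ∀ k j, P.map (X k j) = ν k)
    (hXindep : iIndepFun (fun p : Fin K × ℕ => X p.1 p.2) P)
    {F : Sample S A Rmax n → ℝ} (hF : Measurable F) :
    iIndepFun (fun i ω => F (block X n i ω)) P ∧
    ∀ i, IdentDistrib (fun ω => F (block X n i ω)) (fun ω => F (block X n 0 ω)) P P := by
  set g : ℕ × SampleIndex n → Fin K × ℕ := fun q => (q.2.1, q.1 * n q.2.1 + q.2.2)
    with hg
  have hginj : Function.Injective g := by
    rintro ⟨i, ⟨k, j⟩⟩ ⟨i', ⟨k', j'⟩⟩ h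
    simp only [hg, Prod.mk.injEq] at h
    obtain ⟨rfl, h2⟩ := h
    have hpos : 0 < n k := (Nat.zero_le _).trans_lt j.2
    have hi : i = i' := by
      have e := congrArg (· / n k) h2
      simpa only [add_comm (_ * n k), Nat.add_mul_div_right _ _ hpos, Nat.div_eq_of_lt j.2,
        Nat.div_eq_of_lt j'.2, zero_add] using e
    subst hi
    have hj : j = j' := Fin.ext (by simpa using h2)
    rw [hj]
  have hind := hXindep.precomp hginj
  have hYm : ∀ q, Measurable ((fun p : Fin K × ℕ => X p.1 p.2) (g q)) := fun q => hXm _ _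
  have hrows := iIndepFun_rows (Y := fun q => (fun p : Fin K × ℕ => X p.1 p.2) (g q)) hYm hind
  set T : (SampleIndex n → Obs S A Rmax) → Sample S A Rmax n := fun y k j => y ⟨k, j⟩
    with hT
  have hTm : Measurable T := by rw [hT]; fun_prop
  refine ⟨hrows.comp (fun _ => F ∘ T) fun _ => hF.comp hTm, fun i => ?_⟩
  have hrow : ∀ i, iIndepFun (fun (p : SampleIndex n) =>
      X p.1 (i * n p.1 + p.2)) P := fun i =>
    hind.precomp (g := fun p => (i, p)) fun a b h => (Prod.mk.inj h).2
  exact (IdentDistrib.pi (fun p => ⟨(hXm _ _).aemeasurable, (hXm _ _).aemeasurable,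
    by rw [hXlaw, hXlaw]⟩) (hrow i) (hrow 0)).comp (hF.comp hTm)

omit [MeasurableSpace S] [MeasurableSpace A] [MeasurableSpace Ω] in
lemma block_zero (n : Fin K → ℕ) (ω : Ω) : block X n 0 ω = sampleOf X n ω := by
  ext1 k; ext1 j
  simp [block, sampleOf]

lemma total_scaled (n : Fin K → ℕ) (m : ℕ) : total (scaled n m) = m * total n := by
  simp [total, Finset.mul_sum]

lemma memLp_sum_sample {N : Fin K → ℕ} {ν : Fin K → Measure (Obs S A Rmax)}
    (hXm : ∀ k j, Measurable (X k j)) (hXlaw : ∀ k j, P.map (X k j) = ν k)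
    {f : Fin K → Obs S A Rmax → ℝ} (hf : ∀ k, Measurable (f k))
    (hL2 : ∀ k, 0 < N k → MemLp (f k) 2 (ν k)) :
    MemLp (fun ω => ∑ k, ∑ j, f k (sampleOf X N ω k j)) 2 P ∧
    ∫ ω, ∑ k, ∑ j, f k (sampleOf X N ω k j) ∂P = ∑ k, (N k : ℝ) * ∫ o, f k o ∂(ν k) := by
  have hmem : ∀ k (j : Fin (N k)), MemLp (fun ω => f k (sampleOf X N ω k j)) 2 P := fun k j => by
    have h0 := hL2 k ((Nat.zero_le _).trans_lt j.2)
    rw [← hXlaw k j] at h0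
    exact h0.comp_of_map (hXm _ _).aemeasurable
  refine ⟨memLp_finsetSum _ fun k _ => memLp_finsetSum _ fun j _ => hmem k j, ?_⟩
  rw [integral_finsetSum _ fun k _ => integrable_finsetSum _ fun j _ =>
    (hmem k j).integrable (by norm_num)]
  refine Finset.sum_congr rfl fun k _ => ?_
  rw [integral_finsetSum _ fun j _ => (hmem k j).integrable (by norm_num)]
  have : ∀ j : Fin (N k), ∫ ω, f k (sampleOf X N ω k j) ∂P = ∫ o, f k o ∂(ν k) := fun j => by
    rw [← hXlaw k j, integral_map (hXm _ _).aemeasurable (hf k).aestronglyMeasurable]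
    rfl
  simp [this]

/-- The central limit theorem for stratified samples whose strata grow in fixed proportions. It
is the classical one, applied to the sums over blocks of `n k` observations from each logger `k`,
as these are independent and identically distributed. -/
lemma tendstoInDistribution_stratified (n : Fin K → ℕ) (hn : 0 < total n)
    {ν : Fin K → Measure (Obs S A Rmax)}
    (hXm : ∀ k j, Measurable (X k j)) (hXlaw : ∀ k j, P.map (X k j) = ν k)
    (hXindep : iIndepFun (fun p : Fin K × ℕ => X p.1 p.2) P)
    {f : Fin K → Obs S A Rmax → ℝ} (hf : ∀ k, Measurable (f k))
    (hL2 : ∀ k, 0 < n k → MemLp (f k) 2 (ν k)) {J : ℝ}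
    (hJ : ∑ k, (n k : ℝ) * ∫ o, f k o ∂(ν k) = total n * J) :
    MemLp (fun ω => ∑ k, ∑ j, f k (sampleOf X n ω k j)) 2 P ∧
    TendstoInDistribution
      (fun m ω => √(total (scaled n m) : ℝ) *
        ((∑ k, ∑ j, f k (sampleOf X (scaled n m) ω k j)) / (total (scaled n m) : ℝ) - J))
      atTop (id : ℝ → ℝ) (fun _ => P)
      (gaussianReal 0 (Real.toNNReal ((total n : ℝ) *
        variance (fun ω => (∑ k, ∑ j, f k (sampleOf X n ω k j)) / (total n : ℝ)) P))) := by
  have hn0 : (0 : ℝ) < total n := Nat.cast_pos.2 hn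
  obtain ⟨hF2, hmean⟩ := memLp_sum_sample (N := n) hXm hXlaw hf hL2
  rw [hJ] at hmean
  refine ⟨hF2, ?_⟩
  set F : Sample S A Rmax n → ℝ := fun d => ∑ k, ∑ j, f k (d k j) with hF
  change ∫ ω, F (sampleOf X n ω) ∂P = _ at hmean
  have hFm : Measurable F := Finset.measurable_fun_sum _ fun k _ =>
    Finset.measurable_fun_sum _ fun j _ => (hf k).comp (by fun_prop)
  obtain ⟨hind, hid⟩ := block_iIndepFun_identDistrib n ν hXm hXlaw hXindep hFm
  have hY0 : (fun ω => F (block X n 0 ω)) = fun ω => F (sampleOf X n ω) := by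
    simp_rw [block_zero]
  set v : ℝ := variance (fun ω => F (sampleOf X n ω)) P with hv
  have hw : (total n : ℝ) * variance (fun ω => F (sampleOf X n ω) / (total n : ℝ)) P
      = v / total n := by
    have : (fun ω => F (sampleOf X n ω) / (total n : ℝ))
        = fun ω => (total n : ℝ)⁻¹ * F (sampleOf X n ω) := by
      ext ω; rw [div_eq_inv_mul]
    rw [this, variance_const_mul, ← hv]
    field_simp
  change TendstoInDistribution _ _ _ _ (gaussianReal 0 (Real.toNNReal ((total n : ℝ) *
    variance (fun ω => F (sampleOf X n ω) / (total n : ℝ)) P)))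
  rw [hw]
  have hlaw : HasLaw (fun x : ℝ => √(total n : ℝ) * x) (gaussianReal 0 v.toNNReal)
      (gaussianReal 0 (v / total n).toNNReal) := by
    refine ⟨by fun_prop, ?_⟩
    rw [gaussianReal_map_const_mul]
    congr 1
    · simp
    · ext
      have hv0 : 0 ≤ v := variance_nonneg _ _
      push_cast
      rw [Real.coe_toNNReal _ (div_nonneg hv0 hn0.le), Real.coe_toNNReal _ hv0]
      rw [Real.sq_sqrt hn0.le]
      field_simp
  have hclt := tendstoInDistribution_inv_sqrt_mul_sum_sub (P := P)
    (X := fun i ω => F (block X n i ω)) (Y := fun x : ℝ => √(total n : ℝ) * x)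
    (P' := gaussianReal 0 (v / total n).toNNReal)
    (by simp only [hY0]; exact hlaw) (by simp only [hY0]; exact hF2) hind hid
  have hcomp := hclt.continuous_comp (g := fun x : ℝ => (√(total n : ℝ))⁻¹ * x) (by fun_prop)
  have hs : √(total n : ℝ) ≠ 0 := (Real.sqrt_pos.2 hn0).ne'
  convert hcomp using 1
  · ext m ω
    have hsum : ∑ i ∈ Finset.range m, F (block X n i ω)
        = ∑ k, ∑ j, f k (sampleOf X (scaled n m) ω k j) := by
      simp only [hF]
      rw [Finset.sum_comm]
      exact Finset.sum_congr rfl fun k _ => sum_range_mul_eq (fun l => f k (X k l ω)) m (n k)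
    simp only [Function.comp_apply, hY0, hmean, hsum]
    rw [total_scaled]
    push_cast
    rcases Nat.eq_zero_or_pos m with h0 | h0
    · simp [h0]
    · have hm : (0 : ℝ) < m := Nat.cast_pos.2 h0
      have e1 : √(m : ℝ) ≠ 0 := (Real.sqrt_pos.2 hm).ne'
      rw [Real.sqrt_mul hm.le]
      have e2 := Real.sq_sqrt hm.le
      have e3 := Real.sq_sqrt hn0.le
      generalize (∑ k, ∑ j, f k (sampleOf X (scaled n m) ω k j)) = T
      field_simp
      rw [e2, e3]
  · ext x
    simp only [Function.comp_apply, id]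
    field_simp

end BlockCLT

/-! ### Bounding the effect of fitting errors in `L²` -/

section L2Bound

variable {S A : Type*} [MeasurableSpace S] [MeasurableSpace A] {lam : Measure A} {Rmax : ℝ}
  {K : ℕ} [SigmaFinite lam]

/-- `Σ_k n_k E_{π_k}[f(k, ·)]`, that is, `n E_{π_*}[f]`. -/
def strataSum (n : Fin K → ℕ) (pS : Measure S) (polL : Fin K → Policy S lam)
    (pR : Kernel (S × A) (Set.Icc (0 : ℝ) Rmax)) (f : Fin K → Obs S A Rmax → ℝ) : ℝ :=
  ∑ k, (n k : ℝ) * ∫ o, f k o ∂(obsLaw pS (polL k) pR)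

/-- `n E_{π_*}[π^e(a ∣ s)² 1{π^e(a ∣ s) > M}]`. -/
def tailSum (n : Fin K → ℕ) (pS : Measure S) (polL : Fin K → Policy S lam)
    (pR : Kernel (S × A) (Set.Icc (0 : ℝ) Rmax)) (polE : Policy S lam) (M : ℝ) : ℝ :=
  strataSum n pS polL pR fun _ o =>
    {o : Obs S A Rmax | M < polE.dens o.1.1 o.1.2}.indicator
      (fun o => (polE.dens o.1.1 o.1.2) ^ 2) o

variable {pS : Measure S} [IsProbabilityMeasure pS]
  {pR : Kernel (S × A) (Set.Icc (0 : ℝ) Rmax)} [IsMarkovKernel pR]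
  {n : Fin K → ℕ} {polL : Fin K → Policy S lam} {polE : Policy S lam}

omit [IsProbabilityMeasure pS] [IsMarkovKernel pR] in
lemma strataSum_mono {f f' : Fin K → Obs S A Rmax → ℝ}
    (hf : ∀ k, 0 < n k → Integrable (f k) (obsLaw pS (polL k) pR))
    (hf' : ∀ k, 0 < n k → Integrable (f' k) (obsLaw pS (polL k) pR))
    (hle : ∀ k o, f k o ≤ f' k o) :
    strataSum n pS polL pR f ≤ strataSum n pS polL pR f' := by
  refine Finset.sum_le_sum fun k _ => ?_
  rcases Nat.eq_zero_or_pos (n k) with h0 | h0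
  · simp [h0]
  · exact mul_le_mul_of_nonneg_left (integral_mono (hf k h0) (hf' k h0) (hle k))
      (Nat.cast_nonneg _)

omit [IsProbabilityMeasure pS] [IsMarkovKernel pR] in
lemma strataSum_add {f f' : Fin K → Obs S A Rmax → ℝ}
    (hf : ∀ k, 0 < n k → Integrable (f k) (obsLaw pS (polL k) pR))
    (hf' : ∀ k, 0 < n k → Integrable (f' k) (obsLaw pS (polL k) pR)) :
    strataSum n pS polL pR (fun k o => f k o + f' k o)
      = strataSum n pS polL pR f + strataSum n pS polL pR f' := by
  unfold strataSum
  rw [← Finset.sum_add_distrib]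
  refine Finset.sum_congr rfl fun k _ => ?_
  rcases Nat.eq_zero_or_pos (n k) with h0 | h0
  · simp [h0]
  · rw [integral_add (hf k h0) (hf' k h0), mul_add]

omit [IsProbabilityMeasure pS] [IsMarkovKernel pR] in
lemma strataSum_const_mul (c : ℝ) (f : Fin K → Obs S A Rmax → ℝ) :
    strataSum n pS polL pR (fun k o => c * f k o) = c * strataSum n pS polL pR f := by
  simp only [strataSum, integral_const_mul, Finset.mul_sum]
  exact Finset.sum_congr rfl fun k _ => by ring

omit [IsProbabilityMeasure pS] [IsMarkovKernel pR] in
lemma strataSum_nonneg {f : Fin K → Obs S A Rmax → ℝ} (hf : ∀ k o, 0 ≤ f k o) :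
    0 ≤ strataSum n pS polL pR f :=
  Finset.sum_nonneg fun k _ => mul_nonneg (Nat.cast_nonneg _) (integral_nonneg (hf k))

omit [IsProbabilityMeasure pS] [IsMarkovKernel pR] in
lemma strataSum_sq_eq (hn : 0 < total n) (f : Fin K → S → A → ℝ) :
    strataSum n pS polL pR (fun k o => (f k o.1.1 o.1.2) ^ 2)
      = total n * (l2Norm n pS polL pR f) ^ 2 := by
  have hn0 : (0 : ℝ) < total n := Nat.cast_pos.2 hn
  rw [l2Norm, Real.sq_sqrt, strataSum, Finset.mul_sum]
  · refine Finset.sum_congr rfl fun k _ => ?_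
    field_simp
  · exact Finset.sum_nonneg fun k _ => mul_nonneg (by positivity)
      (integral_nonneg fun _ => sq_nonneg _)

omit [IsProbabilityMeasure pS] [IsMarkovKernel pR] in
lemma integrable_tail (hsq : ∀ k, 0 < n k → Integrable
      (fun o : Obs S A Rmax => (polE.dens o.1.1 o.1.2) ^ 2) (obsLaw pS (polL k) pR))
    (M : ℝ) (k : Fin K) (hk : 0 < n k) :
    Integrable (fun o => {o : Obs S A Rmax | M < polE.dens o.1.1 o.1.2}.indicator
      (fun o => (polE.dens o.1.1 o.1.2) ^ 2) o) (obsLaw pS (polL k) pR) :=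
  (hsq k hk).indicator (measurableSet_lt measurable_const polE.measurable_dens_obs)

omit [IsProbabilityMeasure pS] [IsMarkovKernel pR] in
lemma tendsto_tailSum (hsq : ∀ k, 0 < n k → Integrable
      (fun o : Obs S A Rmax => (polE.dens o.1.1 o.1.2) ^ 2) (obsLaw pS (polL k) pR)) :
    Tendsto (fun M : ℕ => tailSum n pS polL pR polE M) atTop (𝓝 0) := by
  have : Tendsto (fun M : ℕ => tailSum n pS polL pR polE M) atTop
      (𝓝 (∑ k, (n k : ℝ) * 0)) := by
    refine tendsto_finsetSum _ fun k _ => ?_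
    rcases Nat.eq_zero_or_pos (n k) with h0 | h0
    · simp [h0]
    refine Tendsto.const_mul _ ?_
    have hlim := tendsto_integral_of_dominated_convergence (μ := obsLaw pS (polL k) pR)
      (F := fun (M : ℕ) (o : Obs S A Rmax) =>
        {o : Obs S A Rmax | (M : ℝ) < polE.dens o.1.1 o.1.2}.indicator
          (fun o => (polE.dens o.1.1 o.1.2) ^ 2) o) (f := fun _ => 0)
      (fun o => (polE.dens o.1.1 o.1.2) ^ 2)
      (fun M => (integrable_tail hsq M k h0).aestronglyMeasurable) (hsq k h0) ?_ ?_
    · simpa using hlim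
    · refine fun M => ae_of_all _ fun o => ?_
      rw [Set.indicator_apply]
      split_ifs
      · simp
      · simpa using sq_nonneg _
    · refine ae_of_all _ fun o => tendsto_const_nhds.congr' ?_
      obtain ⟨M₀, hM₀⟩ := exists_nat_gt (polE.dens o.1.1 o.1.2)
      filter_upwards [eventually_ge_atTop M₀] with M hM
      rw [Set.indicator_of_notMem]
      simp only [Set.mem_ofPred_eq, not_lt]
      exact hM₀.le.trans (Nat.cast_le.2 hM)
  simpa using this

lemma integrable_mul_one_add_sq (hsq : ∀ k, 0 < n k → Integrable
      (fun o : Obs S A Rmax => (polE.dens o.1.1 o.1.2) ^ 2) (obsLaw pS (polL k) pR))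
    {D : ℝ} {F : Fin K → Obs S A Rmax → ℝ} (hFm : ∀ k, Measurable (F k))
    (hF : ∀ k o, |F k o| ≤ D * (1 + (polE.dens o.1.1 o.1.2) ^ 2)) (k : Fin K) (hk : 0 < n k) :
    Integrable (F k) (obsLaw pS (polL k) pR) :=
  Integrable.mono' (((integrable_const 1).add (hsq k hk)).const_mul D)
    (hFm k).aestronglyMeasurable (ae_of_all _ fun o => hF k o)

/-- Truncation at `π^e(a ∣ s) ≤ M`: a bounded function that is small in `L²` remains so after
multiplication by `(1 + π^e(a ∣ s)²)^{1/2}`. -/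
lemma strataSum_sq_mul_le (hsq : ∀ k, 0 < n k → Integrable
      (fun o : Obs S A Rmax => (polE.dens o.1.1 o.1.2) ^ 2) (obsLaw pS (polL k) pR))
    {D : ℝ} {f : Fin K → S → A → ℝ} (hfm : ∀ k, Measurable (Function.uncurry (f k)))
    (hf : ∀ k s a, |f k s a| ≤ D) (M : ℝ) :
    strataSum n pS polL pR
        (fun k o => (f k o.1.1 o.1.2) ^ 2 * (1 + (polE.dens o.1.1 o.1.2) ^ 2))
      ≤ (1 + M ^ 2) * strataSum n pS polL pR (fun k o => (f k o.1.1 o.1.2) ^ 2)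
        + D ^ 2 * tailSum n pS polL pR polE M := by
  have hfo : ∀ k, Measurable fun o : Obs S A Rmax => f k o.1.1 o.1.2 :=
    fun k => (hfm k).comp measurable_fst
  have hfD : ∀ k (o : Obs S A Rmax), (f k o.1.1 o.1.2) ^ 2 ≤ D ^ 2 := fun k o =>
    sq_le_sq' (by linarith [(abs_le.1 (hf k o.1.1 o.1.2)).1]) (abs_le.1 (hf k o.1.1 o.1.2)).2
  have i1 : ∀ k, 0 < n k → Integrable (fun o : Obs S A Rmax => (f k o.1.1 o.1.2) ^ 2)
      (obsLaw pS (polL k) pR) := fun k _ =>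
    Integrable.of_bound ((hfo k).pow_const 2).aestronglyMeasurable (D ^ 2)
      (ae_of_all _ fun o => by rw [Real.norm_eq_abs, abs_of_nonneg (sq_nonneg _)]; exact hfD k o)
  have i2 := integrable_tail (pS := pS) (pR := pR) hsq M
  rw [tailSum, ← strataSum_const_mul, ← strataSum_const_mul, ← strataSum_add
    (fun k hk => (i1 k hk).const_mul _) (fun k hk => (i2 k hk).const_mul _)]
  refine strataSum_mono (integrable_mul_one_add_sq hsq (D := D ^ 2)
    (fun k => ((hfo k).pow_const 2).mul
      (measurable_const.add (polE.measurable_dens_obs.pow_const 2))) fun k o => ?_)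
    (fun k hk => ((i1 k hk).const_mul _).add ((i2 k hk).const_mul _)) fun k o => ?_
  · rw [abs_of_nonneg (by positivity)]
    exact mul_le_mul_of_nonneg_right (hfD k o) (by positivity)
  · have h1 := hfD k o
    have h0 := sq_nonneg (f k o.1.1 o.1.2)
    have hd := polE.dens_nonneg o.1.1 o.1.2
    rw [Set.indicator_apply]
    split_ifs with h
    · have := mul_le_mul_of_nonneg_right h1 (sq_nonneg (polE.dens o.1.1 o.1.2))
      have := mul_nonneg (sq_nonneg M) h0
      nlinarith
    · have hM : polE.dens o.1.1 o.1.2 ≤ M := not_lt.1 h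
      have : (polE.dens o.1.1 o.1.2) ^ 2 ≤ M ^ 2 := by gcongr
      have := mul_le_mul_of_nonneg_left this h0
      nlinarith

/-- Since `h ≤ C`, the constraint forces `n ≤ C Σ_k n_k π_k(a ∣ s)` where `π^e(a ∣ s) > 0`, so
that the mean under the target policy is controlled by the means under the loggers. -/
lemma mul_integral_target_le (hsq : ∀ k, 0 < n k → Integrable
      (fun o : Obs S A Rmax => (polE.dens o.1.1 o.1.2) ^ 2) (obsLaw pS (polL k) pR))
    {C D : ℝ} {h : Fin K → S → A → ℝ} (hh : ∀ k s a, |h k s a| ≤ C)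
    (hc : WeightConstraint n polL polE h)
    {F : S × A → ℝ} (hFm : Measurable F) (hF0 : ∀ p, 0 ≤ F p) (hFD : ∀ p, F p ≤ D) :
    (total n : ℝ) * ∫ o, F o.1 ∂(obsLaw pS polE pR)
      ≤ C * strataSum n pS polL pR fun _ o => polE.dens o.1.1 o.1.2 * F o.1 := by
  set Λ := baseLaw lam pS pR
  have hFo : Measurable fun o : Obs S A Rmax => F o.1 := hFm.comp measurable_fst
  have i1 : ∀ k, 0 < n k → Integrable (fun o : Obs S A Rmax => polE.dens o.1.1 o.1.2 * F o.1)
      (obsLaw pS (polL k) pR) := fun k hk =>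
    integrable_mul_one_add_sq (n := n) hsq (D := D)
      (F := fun _ (o : Obs S A Rmax) => polE.dens o.1.1 o.1.2 * F o.1)
      (fun k => polE.measurable_dens_obs.mul hFo) (fun k o => by
        have hd := polE.dens_nonneg o.1.1 o.1.2
        have hD : 0 ≤ D := (hF0 o.1).trans (hFD o.1)
        rw [abs_of_nonneg (mul_nonneg hd (hF0 _)), mul_comm]
        refine mul_le_mul (hFD _) ?_ hd hD
        nlinarith [sq_nonneg (polE.dens o.1.1 o.1.2 - 1)]) k hk
  have i2 : ∀ k ∈ (Finset.univ : Finset (Fin K)), Integrable (fun o : Obs S A Rmax => (n k : ℝ) *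
      ((polL k).dens o.1.1 o.1.2 * (polE.dens o.1.1 o.1.2 * F o.1))) Λ := fun k _ => by
    rcases Nat.eq_zero_or_pos (n k) with h0 | h0
    · simp [h0]
    · exact ((integrable_obsLaw_iff _ _).1 (i1 k h0)).const_mul _
  have hs : strataSum n pS polL pR (fun _ o => polE.dens o.1.1 o.1.2 * F o.1)
      = ∫ o, ∑ k, (n k : ℝ) *
          ((polL k).dens o.1.1 o.1.2 * (polE.dens o.1.1 o.1.2 * F o.1)) ∂Λ := by
    rw [integral_finsetSum _ i2]
    simp_rw [strataSum, integral_const_mul, integral_obsLaw]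
    rfl
  rw [hs, integral_obsLaw, ← integral_const_mul, ← integral_const_mul]
  refine integral_mono_of_nonneg (ae_of_all _ fun o => ?_)
    ((integrable_finsetSum _ i2).const_mul _) (ae_of_all _ fun o => ?_)
  · exact mul_nonneg (Nat.cast_nonneg _) (mul_nonneg (polE.dens_nonneg _ _) (hF0 _))
  · have hid := hc.ident o.1.1 o.1.2
    change (total n : ℝ) * (polE.dens o.1.1 o.1.2 * F o.1) ≤ _
    rw [← mul_assoc, ← hid, Finset.sum_mul, Finset.sum_mul]
    change _ ≤ C * ∑ k, _
    rw [Finset.mul_sum]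
    refine Finset.sum_le_sum fun k _ => ?_
    have h1 := (abs_le.1 (hh k o.1.1 o.1.2)).2
    have h2 : 0 ≤ (n k : ℝ) * ((polL k).dens o.1.1 o.1.2 * (polE.dens o.1.1 o.1.2 * F o.1)) :=
      mul_nonneg (Nat.cast_nonneg _) (mul_nonneg ((polL k).dens_nonneg _ _)
        (mul_nonneg (polE.dens_nonneg _ _) (hF0 _)))
    calc _ = h k o.1.1 o.1.2 *
          ((n k : ℝ) * ((polL k).dens o.1.1 o.1.2 * (polE.dens o.1.1 o.1.2 * F o.1))) := by ring
      _ ≤ _ := mul_le_mul_of_nonneg_right h1 h2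

/-- The effect on the summands of replacing `h` and `g` by other functions is controlled by the
`L²` distances of these, up to a truncation error. -/
lemma strataSum_score_sub_le (hn : 0 < total n) (hsq : ∀ k, 0 < n k → Integrable
      (fun o : Obs S A Rmax => (polE.dens o.1.1 o.1.2) ^ 2) (obsLaw pS (polL k) pR))
    {C : ℝ} (hC : 0 ≤ C) {h h' : Fin K → S → A → ℝ} {g g' : S → A → ℝ}
    (hhm : ∀ k, Measurable (Function.uncurry (h k)))
    (hhm' : ∀ k, Measurable (Function.uncurry (h' k)))
    (hgm : Measurable (Function.uncurry g)) (hgm' : Measurable (Function.uncurry g'))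
    (hh : ∀ k s a, |h k s a| ≤ C) (hh' : ∀ k s a, |h' k s a| ≤ C)
    (hg : ∀ s a, |g s a| ≤ C) (hg' : ∀ s a, |g' s a| ≤ C)
    (hc : WeightConstraint n polL polE h) (M : ℝ) :
    strataSum n pS polL pR (fun k o => (score polE h' g' k o - score polE h g k o) ^ 2)
      ≤ 3 * ((Rmax + C) ^ 2 + C ^ 2 + C) * ((1 + M ^ 2) * (total n : ℝ) *
          ((l2Norm n pS polL pR fun k s a => h' k s a - h k s a) ^ 2
            + (l2Norm n pS polL pR fun _ s a => g' s a - g s a) ^ 2)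
        + 4 * C ^ 2 * tailSum n pS polL pR polE M) := by
  set τ := tailSum n pS polL pR polE M
  set x : Fin K → S → A → ℝ := fun k s a => h' k s a - h k s a with hx
  set y : Fin K → S → A → ℝ := fun _ s a => g' s a - g s a with hy
  set q : S → ℝ := fun s => ∫ a, (g' s a - g s a) * polE.dens s a ∂lam with hq
  have hxm : ∀ k, Measurable (Function.uncurry (x k)) := fun k => (hhm' k).sub (hhm k)
  have hym : ∀ k, Measurable (Function.uncurry (y k)) := fun _ => hgm'.sub hgm
  have hxC : ∀ k s a, |x k s a| ≤ 2 * C := fun k s a =>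
    (abs_sub _ _).trans (by linarith [hh k s a, hh' k s a])
  have hyC' : ∀ s a, |g' s a - g s a| ≤ 2 * C := fun s a =>
    (abs_sub _ _).trans (by linarith [hg s a, hg' s a])
  have hyC : ∀ k s a, |y k s a| ≤ 2 * C := fun _ => hyC'
  have hqm : Measurable q :=
    (((hgm'.sub hgm).mul polE.measurable_dens).stronglyMeasurable.integral_prod_right
      (ν := lam)).measurable
  have hqC : ∀ s, |q s| ≤ 2 * C := fun s => polE.abs_integral_dens_le s (hyC' s)
  set w : Fin K → Obs S A Rmax → ℝ := fun _ o => 1 + (polE.dens o.1.1 o.1.2) ^ 2 with hw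
  have hwm : ∀ k, Measurable (w k) := fun k =>
    measurable_const.add (polE.measurable_dens_obs.pow_const 2)
  have hdw : ∀ k o, polE.dens o.1.1 o.1.2 ≤ w k o := fun k o => by
    simp only [hw]
    nlinarith [sq_nonneg (polE.dens o.1.1 o.1.2 - 1), polE.dens_nonneg o.1.1 o.1.2]
  have hsq4 : ∀ t : ℝ, |t| ≤ 2 * C → t ^ 2 ≤ 4 * C ^ 2 := fun t ht => by
    have := sq_le_sq' (by linarith [(abs_le.1 ht).1]) (abs_le.1 ht).2
    linarith
  have hw0 : ∀ k o, 0 ≤ w k o := fun k o => by positivity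
  have hint : ∀ {f : Fin K → S → A → ℝ}, (∀ k, Measurable (Function.uncurry (f k))) →
      (∀ k s a, |f k s a| ≤ 2 * C) → ∀ k, 0 < n k →
      Integrable (fun o => (f k o.1.1 o.1.2) ^ 2 * w k o) (obsLaw pS (polL k) pR) :=
    fun {f} hfm hf k hk => integrable_mul_one_add_sq hsq (D := 4 * C ^ 2)
      (F := fun k (o : Obs S A Rmax) => (f k o.1.1 o.1.2) ^ 2 * w k o)
      (fun k => (((hfm k).comp measurable_fst).pow_const 2).mul (hwm k)) (fun k o => by
        rw [abs_of_nonneg (mul_nonneg (sq_nonneg _) (hw0 k o))]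
        exact mul_le_mul_of_nonneg_right (hsq4 _ (hf _ _ _)) (hw0 k o)) k hk
  have hintq : ∀ k, 0 < n k →
      Integrable (fun o => (q o.1.1) ^ 2) (obsLaw pS (polL k) pR) := fun k _ =>
    Integrable.of_bound
      ((hqm.comp (measurable_fst.comp measurable_fst)).pow_const 2).aestronglyMeasurable
      (4 * C ^ 2) (ae_of_all _ fun o => by
        rw [Real.norm_eq_abs, abs_of_nonneg (sq_nonneg _)]
        exact hsq4 _ (hqC _))
  set T := (1 + M ^ 2) * (total n : ℝ) *
    ((l2Norm n pS polL pR x) ^ 2 + (l2Norm n pS polL pR y) ^ 2) + 4 * C ^ 2 * τ with hT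
  have hxT : strataSum n pS polL pR (fun k o => (x k o.1.1 o.1.2) ^ 2 * w k o) ≤ T := by
    have := strataSum_sq_mul_le (pS := pS) (pR := pR) hsq hxm hxC M
    rw [strataSum_sq_eq hn] at this
    have h0 : 0 ≤ (1 + M ^ 2) * (total n : ℝ) * (l2Norm n pS polL pR y) ^ 2 := by positivity
    refine this.trans ?_
    rw [hT]
    linarith
  have hyT : strataSum n pS polL pR (fun k o => (y k o.1.1 o.1.2) ^ 2 * w k o) ≤ T := by
    have := strataSum_sq_mul_le (pS := pS) (pR := pR) hsq hym hyC M
    rw [strataSum_sq_eq hn] at this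
    have h0 : 0 ≤ (1 + M ^ 2) * (total n : ℝ) * (l2Norm n pS polL pR x) ^ 2 := by positivity
    refine this.trans ?_
    rw [hT]
    linarith
  have hqT : strataSum n pS polL pR (fun _ o => (q o.1.1) ^ 2) ≤ C * T := by
    have e1 : strataSum n pS polL pR (fun _ o => (q o.1.1) ^ 2)
        = total n * ∫ s, (q s) ^ 2 ∂pS := by
      simp_rw [strataSum, integral_obsLaw_context (F := fun s => (q s) ^ 2) _ (hqm.pow_const 2)]
      rw [← Finset.sum_mul, total]
      push_cast
      rfl
    have hFm : Measurable fun p : S × A => (g' p.1 p.2 - g p.1 p.2) ^ 2 :=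
      (hgm'.sub hgm).pow_const 2
    have hFC : ∀ p : S × A, (g' p.1 p.2 - g p.1 p.2) ^ 2 ≤ 4 * C ^ 2 := fun p =>
      hsq4 _ (hyC' _ _)
    have e2 : ∫ s, (q s) ^ 2 ∂pS
        ≤ ∫ o, (g' o.1.1 o.1.2 - g o.1.1 o.1.2) ^ 2 ∂(obsLaw pS polE pR) := by
      rw [integral_obsLaw_action (pR := pR) polE (F := fun p => (g' p.1 p.2 - g p.1 p.2) ^ 2) hFm
        (C := 4 * C ^ 2) (fun p => by rw [abs_of_nonneg (sq_nonneg _)]; exact hFC p)]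
      refine integral_mono_of_nonneg (ae_of_all _ fun _ => sq_nonneg _) ?_ (ae_of_all _ fun s => ?_)
      · refine Integrable.of_bound (C := 4 * C ^ 2) (Measurable.aestronglyMeasurable ?_)
          (ae_of_all _ fun s => ?_)
        · exact ((hFm.mul polE.measurable_dens).stronglyMeasurable.integral_prod_right
            (ν := lam)).measurable
        · exact polE.abs_integral_dens_le s (f := fun a => (g' s a - g s a) ^ 2)
            fun a => by rw [abs_of_nonneg (sq_nonneg _)]; exact hFC (s, a)
      · exact polE.sq_integral_dens_le s (f := fun a => g' s a - g s a)
          ((hgm'.sub hgm).comp measurable_prodMk_left) (hyC' s)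
    have e3 := mul_integral_target_le (pS := pS) (pR := pR) hsq hh hc
      (F := fun p => (g' p.1 p.2 - g p.1 p.2) ^ 2) hFm (fun _ => sq_nonneg _) hFC
    have e4 : strataSum n pS polL pR (fun _ o =>
          polE.dens o.1.1 o.1.2 * (g' o.1.1 o.1.2 - g o.1.1 o.1.2) ^ 2)
        ≤ strataSum n pS polL pR (fun k o => (y k o.1.1 o.1.2) ^ 2 * w k o) := by
      have hle : ∀ k (o : Obs S A Rmax),
          polE.dens o.1.1 o.1.2 * (g' o.1.1 o.1.2 - g o.1.1 o.1.2) ^ 2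
            ≤ (y k o.1.1 o.1.2) ^ 2 * w k o := fun k o => by
        rw [mul_comm]
        exact mul_le_mul_of_nonneg_left (hdw k o) (sq_nonneg _)
      refine strataSum_mono (fun k hk => (hint hym hyC k hk).mono'
        (polE.measurable_dens_obs.mul (hFm.comp measurable_fst)).aestronglyMeasurable
        (ae_of_all _ fun o => ?_)) (hint hym hyC) hle
      rw [Real.norm_eq_abs, abs_of_nonneg (mul_nonneg (polE.dens_nonneg _ _) (sq_nonneg _))]
      exact hle k o
    rw [e1]
    calc _ ≤ (total n : ℝ) * _ := mul_le_mul_of_nonneg_left e2 (Nat.cast_nonneg _)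
      _ ≤ C * _ := e3
      _ ≤ C * T := mul_le_mul_of_nonneg_left (e4.trans hyT) hC
  have hdecomp : ∀ k (o : Obs S A Rmax), score polE h' g' k o - score polE h g k o
      = x k o.1.1 o.1.2 * polE.dens o.1.1 o.1.2 * ((o.2 : ℝ) - g' o.1.1 o.1.2)
        - h k o.1.1 o.1.2 * polE.dens o.1.1 o.1.2 * y k o.1.1 o.1.2 + q o.1.1 := fun k o => by
    have : q o.1.1 = (∫ a, g' o.1.1 a * polE.dens o.1.1 a ∂lam)
        - ∫ a, g o.1.1 a * polE.dens o.1.1 a ∂lam := by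
      rw [← integral_sub
        (polE.integrable_mul_dens _ (f := g' o.1.1) (hgm'.comp measurable_prodMk_left) (hg' _))
        (polE.integrable_mul_dens _ (f := g o.1.1) (hgm.comp measurable_prodMk_left) (hg _))]
      simp only [hq, sub_mul]
    simp only [score, hx, hy, this]
    ring
  have hpt : ∀ k (o : Obs S A Rmax), (score polE h' g' k o - score polE h g k o) ^ 2
      ≤ 3 * (Rmax + C) ^ 2 * ((x k o.1.1 o.1.2) ^ 2 * w k o)
        + (3 * C ^ 2 * ((y k o.1.1 o.1.2) ^ 2 * w k o) + 3 * (q o.1.1) ^ 2) := fun k o => by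
    have hr : ((o.2 : ℝ) - g' o.1.1 o.1.2) ^ 2 ≤ (Rmax + C) ^ 2 := by
      have a1 := o.2.2.1
      have a2 := o.2.2.2
      have a3 := abs_le.1 (hg' o.1.1 o.1.2)
      exact sq_le_sq' (by linarith) (by linarith)
    have hhs : (h k o.1.1 o.1.2) ^ 2 ≤ C ^ 2 := by
      have a3 := abs_le.1 (hh k o.1.1 o.1.2)
      exact sq_le_sq' (by linarith) (by linarith)
    have hdw2 : (polE.dens o.1.1 o.1.2) ^ 2 ≤ w k o := by simp only [hw]; linarith
    rw [hdecomp]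
    set a := x k o.1.1 o.1.2 * polE.dens o.1.1 o.1.2 * ((o.2 : ℝ) - g' o.1.1 o.1.2) with ha
    set b := h k o.1.1 o.1.2 * polE.dens o.1.1 o.1.2 * y k o.1.1 o.1.2 with hb
    have ha2 : a ^ 2 ≤ (Rmax + C) ^ 2 * ((x k o.1.1 o.1.2) ^ 2 * w k o) := by
      calc a ^ 2 = ((o.2 : ℝ) - g' o.1.1 o.1.2) ^ 2 *
            ((x k o.1.1 o.1.2) ^ 2 * (polE.dens o.1.1 o.1.2) ^ 2) := by rw [ha]; ring
        _ ≤ _ := by gcongr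
    have hb2 : b ^ 2 ≤ C ^ 2 * ((y k o.1.1 o.1.2) ^ 2 * w k o) := by
      calc b ^ 2 = (h k o.1.1 o.1.2) ^ 2 *
            ((y k o.1.1 o.1.2) ^ 2 * (polE.dens o.1.1 o.1.2) ^ 2) := by rw [hb]; ring
        _ ≤ _ := by gcongr
    have h3 : ∀ c : ℝ, (a - b + c) ^ 2 ≤ 3 * a ^ 2 + (3 * b ^ 2 + 3 * c ^ 2) := fun c => by
      nlinarith [sq_nonneg (a + b), sq_nonneg (a - c), sq_nonneg (b + c)]
    linarith [h3 (q o.1.1)]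
  have i1 := fun k hk => (hint hxm hxC k hk).const_mul (3 * (Rmax + C) ^ 2)
  have i2 := fun k hk => (hint hym hyC k hk).const_mul (3 * C ^ 2)
  have i3 := fun k hk => (hintq k hk).const_mul 3
  have i23 : ∀ k, 0 < n k → Integrable (fun o => 3 * C ^ 2 * ((y k o.1.1 o.1.2) ^ 2 * w k o)
      + 3 * (q o.1.1) ^ 2) (obsLaw pS (polL k) pR) := fun k hk => (i2 k hk).add (i3 k hk)
  have i123 := fun k hk => (i1 k hk).add (i23 k hk)
  refine (strataSum_mono (f' := fun k (o : Obs S A Rmax) =>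
      3 * (Rmax + C) ^ 2 * ((x k o.1.1 o.1.2) ^ 2 * w k o)
        + (3 * C ^ 2 * ((y k o.1.1 o.1.2) ^ 2 * w k o) + 3 * (q o.1.1) ^ 2))
    (fun k hk => (i123 k hk).mono' ?_ (ae_of_all _ fun o => ?_)) i123 hpt).trans ?_
  · exact (((measurable_score_right polE k (hhm' k) hgm').sub
      (measurable_score_right polE k (hhm k) hgm)).pow_const 2).aestronglyMeasurable
  · rw [Real.norm_eq_abs, abs_of_nonneg (sq_nonneg _)]
    exact hpt k o
  · rw [strataSum_add i1 i23, strataSum_add i2 i3, strataSum_const_mul, strataSum_const_mul,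
      strataSum_const_mul]
    have m1 := mul_le_mul_of_nonneg_left hxT (sq_nonneg (Rmax + C))
    have m2 := mul_le_mul_of_nonneg_left hyT (sq_nonneg C)
    linarith

end L2Bound

/-! ### Convergence in probability of bounded variables -/

section ConvergenceInMeasure

variable {Ω : Type*} [MeasurableSpace Ω] {P : Measure Ω} [IsProbabilityMeasure P]

/-- A bounded convergence theorem in probability: `v` is bounded, and small where `u` and `w` are,
up to an error `b M` that can be made small at the price of a large factor `a M`. -/
lemma tendsto_integral_of_le_sq_add_sq {u w v : ℕ → Ω → ℝ} {D : ℝ} {a b : ℕ → ℝ}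
    (hv : ∀ m, Measurable (v m)) (hv0 : ∀ m ω, 0 ≤ v m ω)
    (hvD : ∀ m, 0 < m → ∀ᵐ ω ∂P, v m ω ≤ D)
    (hu0 : ∀ m ω, 0 ≤ u m ω) (hw0 : ∀ m ω, 0 ≤ w m ω)
    (hu : TendstoInMeasure P u atTop (fun _ => (0 : ℝ)))
    (hw : TendstoInMeasure P w atTop (fun _ => (0 : ℝ)))
    (ha : ∀ M, 0 ≤ a M) (hb : Tendsto b atTop (𝓝 0))
    (hle : ∀ m, 0 < m → ∀ᵐ ω ∂P, ∀ M, v m ω ≤ a M * (u m ω ^ 2 + w m ω ^ 2) + b M) :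
    Tendsto (fun m => ∫ ω, v m ω ∂P) atTop (𝓝 0) := by
  rw [tendstoInMeasure_iff_measureReal_norm] at hu hw
  rw [Metric.tendsto_atTop]
  intro δ hδ
  obtain ⟨M, hM⟩ := (hb.eventually (gt_mem_nhds (show (0 : ℝ) < δ / 4 by linarith))).exists
  -- the choice of `η` makes `a M * (η ^ 2 + η ^ 2) ≤ δ / 4`
  set η : ℝ := √(δ / (8 * (a M + 1))) with hη
  have hpos : 0 < δ / (8 * (a M + 1)) := by have := ha M; positivity
  have hη0 : 0 < η := Real.sqrt_pos.2 hpos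
  have hη2 : a M * (η ^ 2 + η ^ 2) ≤ δ / 4 := by
    rw [hη, Real.sq_sqrt hpos.le]
    have h1 : 0 < a M + 1 := by linarith [ha M]
    have : a M * (δ / (8 * (a M + 1)) + δ / (8 * (a M + 1))) = (a M / (a M + 1)) * (δ / 4) := by
      field_simp
      ring
    rw [this]
    have h2 : a M / (a M + 1) ≤ 1 := (div_le_one h1).2 (by linarith)
    nlinarith
  have hlim : Tendsto (fun m => |D| * (P.real {ω | η ≤ ‖u m ω - 0‖} + P.real {ω | η ≤ ‖w m ω - 0‖}))
      atTop (𝓝 (|D| * (0 + 0))) := ((hu η hη0).add (hw η hη0)).const_mul _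
  rw [add_zero, mul_zero] at hlim
  obtain ⟨m₀, hm₀⟩ := eventually_atTop.1
    (hlim.eventually (gt_mem_nhds (show (0 : ℝ) < δ / 2 by linarith)))
  refine ⟨max m₀ 1, fun m hm => ?_⟩
  have hm1 : 0 < m := (le_max_right m₀ 1).trans hm
  have hm2 := hm₀ m ((le_max_left m₀ 1).trans hm)
  set B : Set Ω := {ω | δ / 2 < v m ω}
  have hBm : MeasurableSet B := measurableSet_lt measurable_const (hv m)
  have hPB : P.real B ≤ P.real {ω | η ≤ ‖u m ω - 0‖} + P.real {ω | η ≤ ‖w m ω - 0‖} := by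
    refine le_trans ?_ (measureReal_union_le _ _)
    refine ENNReal.toReal_mono (measure_ne_top _ _) (measure_mono_ae ?_)
    filter_upwards [hle m hm1] with ω hω hωB
    by_contra hcon
    have hcon' : ¬ (η ≤ ‖u m ω - 0‖ ∨ η ≤ ‖w m ω - 0‖) := hcon
    rw [not_or, not_le, not_le, sub_zero, sub_zero, Real.norm_eq_abs, Real.norm_eq_abs,
      abs_of_nonneg (hu0 m ω), abs_of_nonneg (hw0 m ω)] at hcon'
    have hb' : δ / 2 < v m ω := hωB
    have e1 : u m ω ^ 2 ≤ η ^ 2 := pow_le_pow_left₀ (hu0 m ω) hcon'.1.le 2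
    have e2 : w m ω ^ 2 ≤ η ^ 2 := pow_le_pow_left₀ (hw0 m ω) hcon'.2.le 2
    have e3 := mul_le_mul_of_nonneg_left (add_le_add e1 e2) (ha M)
    linarith [hω M]
  have hint : ∫ ω, v m ω ∂P ≤ δ / 2 + |D| * P.real B := by
    have : ∫ ω, (δ / 2 + B.indicator (fun _ => |D|) ω) ∂P = δ / 2 + |D| * P.real B := by
      rw [integral_add (integrable_const _) ((integrable_const _).indicator hBm),
        integral_indicator_const _ hBm]
      simp [mul_comm]
    rw [← this]
    refine integral_mono_of_nonneg (ae_of_all _ (hv0 m))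
      ((integrable_const _).add ((integrable_const _).indicator hBm)) ?_
    filter_upwards [hvD m hm1] with ω hω
    change v m ω ≤ δ / 2 + B.indicator (fun _ => |D|) ω
    by_cases h : ω ∈ B
    · rw [Set.indicator_of_mem h]
      linarith [le_abs_self D]
    · rw [Set.indicator_of_notMem h, add_zero]
      exact not_lt.1 h
  rw [Real.dist_eq, sub_zero, abs_of_nonneg (integral_nonneg (hv0 m))]
  linarith [mul_le_mul_of_nonneg_left hPB (abs_nonneg D)]

lemma tendstoInMeasure_of_tendsto_integral_sq {r : ℕ → Ω → ℝ} {c : ℕ → ℝ}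
    (hr : ∀ m, 0 < m → MemLp (r m) 2 P) (hle : ∀ m, 0 < m → ∫ ω, (r m ω) ^ 2 ∂P ≤ c m)
    (hc : Tendsto c atTop (𝓝 0)) : TendstoInMeasure P r atTop (fun _ => (0 : ℝ)) := by
  rw [tendstoInMeasure_iff_measureReal_norm]
  intro ε hε
  have hlim : Tendsto (fun m => c m / ε ^ 2) atTop (𝓝 0) := by simpa using hc.div_const (ε ^ 2)
  refine squeeze_zero' (Eventually.of_forall fun _ => measureReal_nonneg) ?_ hlim
  filter_upwards [eventually_gt_atTop 0] with m hm
  have h1 := mul_meas_ge_le_integral_of_nonneg (μ := P) (f := fun ω => (r m ω) ^ 2)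
    (ae_of_all _ fun _ => sq_nonneg _) (hr m hm).integrable_sq (ε ^ 2)
  have h2 : {ω | ε ≤ ‖r m ω - 0‖} = {ω | ε ^ 2 ≤ (r m ω) ^ 2} := by
    ext ω
    simp only [sub_zero, Real.norm_eq_abs, Set.mem_ofPred_eq]
    rw [← sq_abs (r m ω), sq_le_sq₀ hε.le (abs_nonneg _)]
  rw [h2, le_div_iff₀ (by positivity), mul_comm]
  exact h1.trans (hle m hm)

end ConvergenceInMeasure

/-! ### The means of the fitting errors -/

section Bias

variable {S A : Type*} [MeasurableSpace S] [MeasurableSpace A] {lam : Measure A} {Rmax : ℝ}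
  {K : ℕ} [SigmaFinite lam] {pS : Measure S} [IsProbabilityMeasure pS]
  {pR : Kernel (S × A) (Set.Icc (0 : ℝ) Rmax)} [IsMarkovKernel pR]
  {n : Fin K → ℕ} {polL : Fin K → Policy S lam} {polE : Policy S lam}

/-- Replacing `h` and `g` does not change the mean of the summands when the loggers are averaged in
the proportions `n_k / n`. -/
lemma sum_mul_integral_score_sub (hsq : ∀ k, 0 < n k → Integrable
      (fun o : Obs S A Rmax => (polE.dens o.1.1 o.1.2) ^ 2) (obsLaw pS (polL k) pR))
    {C : ℝ} {h h' : Fin K → S → A → ℝ} {g g' : S → A → ℝ}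
    (hhm : ∀ k, Measurable (Function.uncurry (h k)))
    (hhm' : ∀ k, Measurable (Function.uncurry (h' k)))
    (hgm : Measurable (Function.uncurry g)) (hgm' : Measurable (Function.uncurry g'))
    (hh : ∀ k s a, |h k s a| ≤ C) (hh' : ∀ k s a, |h' k s a| ≤ C)
    (hg : ∀ s a, |g s a| ≤ C) (hg' : ∀ s a, |g' s a| ≤ C)
    (hc : WeightConstraint n polL polE h) (hc' : WeightConstraint n polL polE h') :
    ∑ k, (n k : ℝ) *
      ∫ o, (score polE h' g' k o - score polE h g k o) ∂(obsLaw pS (polL k) pR) = 0 := by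
  have h1 := sum_mul_integral_score n polL polE hsq hhm hgm hh hg hc
  have h2 := sum_mul_integral_score n polL polE hsq hhm' hgm' hh' hg' hc'
  refine Eq.trans ?_ (sub_eq_zero.2 (h2.trans h1.symm))
  rw [← Finset.sum_sub_distrib]
  refine Finset.sum_congr rfl fun k _ => ?_
  rcases Nat.eq_zero_or_pos (n k) with h0 | h0
  · simp [h0]
  · rw [integral_sub, mul_sub]
    · exact (memLp_score polE (polL k) (hsq k h0) (hhm' k) hgm' (hh' k) hg').integrable
        (by norm_num)
    · exact (memLp_score polE (polL k) (hsq k h0) (hhm k) hgm (hh k) hg).integrable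
        (by norm_num)

omit [IsProbabilityMeasure pS] [IsMarkovKernel pR] in
lemma abs_score_sub_le {C : ℝ} {h h' : Fin K → S → A → ℝ} {g g' : S → A → ℝ}
    (hh : ∀ k s a, |h k s a| ≤ C) (hh' : ∀ k s a, |h' k s a| ≤ C)
    (hg : ∀ s a, |g s a| ≤ C) (hg' : ∀ s a, |g' s a| ≤ C) (k : Fin K) (o : Obs S A Rmax) :
    |score polE h' g' k o - score polE h g k o| ≤ 2 * envelope polE C o :=
  (abs_sub _ _).trans (by
    linarith [abs_score_le polE (hh k) hg o, abs_score_le polE (hh' k) hg' o])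

lemma abs_integral_score_sub_le (hsq : ∀ k, 0 < n k → Integrable
      (fun o : Obs S A Rmax => (polE.dens o.1.1 o.1.2) ^ 2) (obsLaw pS (polL k) pR))
    {C : ℝ} {h h' : Fin K → S → A → ℝ} {g g' : S → A → ℝ}
    (hh : ∀ k s a, |h k s a| ≤ C) (hh' : ∀ k s a, |h' k s a| ≤ C)
    (hg : ∀ s a, |g s a| ≤ C) (hg' : ∀ s a, |g' s a| ≤ C) (k : Fin K) (hk : 0 < n k) :
    |∫ o, (score polE h' g' k o - score polE h g k o) ∂(obsLaw pS (polL k) pR)|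
      ≤ ∫ o, 2 * envelope polE C o ∂(obsLaw pS (polL k) pR) := by
  refine abs_integral_le_integral_abs.trans (integral_mono_of_nonneg
    (ae_of_all _ fun _ => abs_nonneg _) ?_
    (ae_of_all _ fun o => abs_score_sub_le hh hh' hg hg' k o))
  exact ((memLp_envelope polE (polL k) C (hsq k hk)).integrable (by norm_num)).const_mul 2

end Bias

/-! ### Decomposition of the estimator and bound on the bias -/

section Decomposition

variable {S A : Type*} [MeasurableSpace S] [MeasurableSpace A] {lam : Measure A} {Rmax : ℝ}
  {K Z : ℕ} {n : Fin K → ℕ}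

/-- The error in the summands that is due to using the functions fitted outside the `z`-th fold
in place of `h` and `g`. -/
def fitError (polE : Policy S lam) (h : Fin K → S → A → ℝ) (g : S → A → ℝ)
    (hhat : Estimator S A Rmax n (Fin K → S → A → ℝ)) (ghat : Estimator S A Rmax n (S → A → ℝ))
    (m : ℕ) (z : Fin Z) : Fitted S A Rmax (scaled n m) Z z :=
  fun φ u k o => score polE (hhat m (trainIdx φ z) u) (ghat m (trainIdx φ z) u) k o
    - score polE h g k o

/-- The sum over all folds of the means of `fitError` under the laws `ν k` of the observations in
the fold. -/
def foldBias (ν : Fin K → Measure (Obs S A Rmax)) {N : Fin K → ℕ}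
    (e : ∀ z : Fin Z, Fitted S A Rmax N Z z) (φ : FoldMap N Z) (d : Sample S A Rmax N) : ℝ :=
  ∑ z, ∑ k, ((foldIdx φ z k).card : ℝ) * ∫ o, e z φ (restrict _ d) k o ∂(ν k)

lemma partSize_mul_Gam (polE : Policy S lam) {N : Fin K → ℕ} (I : IndexSet N)
    (d : Sample S A Rmax N) (h : Fin K → S → A → ℝ) (g : S → A → ℝ) :
    (partSize I : ℝ) * Gam polE I (restrict I d) h g
      = ∑ k, ∑ j ∈ I k, score polE h g k (d k j) := by
  have h1 : ∑ k, ∑ j, score polE h g k (restrict I d k j)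
      = ∑ k, ∑ j ∈ I k, score polE h g k (d k j) :=
    Finset.sum_congr rfl fun k _ => Finset.sum_coe_sort (I k) fun j => score polE h g k (d k j)
  rw [Gam, h1]
  rcases Nat.eq_zero_or_pos (partSize I) with h0 | h0
  · have hc : ∀ k, I k = ∅ := fun k => by
      have := (Finset.sum_eq_zero_iff.1 h0) k (Finset.mem_univ k)
      exact Finset.card_eq_zero.1 this
    simp [hc]
  · have : (partSize I : ℝ) ≠ 0 := (Nat.cast_pos.2 h0).ne'
    field_simp

/-- The estimator is the average of the summands with the true `h` and `g`, plus the centred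
effects of the fitting errors, plus the bias. -/
lemma JBI_eq (ν : Fin K → Measure (Obs S A Rmax)) (polE : Policy S lam) (h : Fin K → S → A → ℝ)
    (g : S → A → ℝ) (hhat : Estimator S A Rmax n (Fin K → S → A → ℝ))
    (ghat : Estimator S A Rmax n (S → A → ℝ))
    (m : ℕ) (φ : FoldMap (scaled n m) Z) (d : Sample S A Rmax (scaled n m)) :
    JBI polE hhat ghat m φ d
      = (∑ k, ∑ j, score polE h g k (d k j)
          + (∑ z, crossSum ν (fitError polE h g hhat ghat m z) φ d
            + foldBias ν (fitError polE h g hhat ghat m) φ d)) / (total (scaled n m) : ℝ) := by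
  rw [JBI]
  congr 1
  simp_rw [partSize_mul_Gam]
  have h1 : ∑ k, ∑ j, score polE h g k (d k j)
      = ∑ z, ∑ k, ∑ j ∈ foldIdx φ z k, score polE h g k (d k j) := by
    rw [Finset.sum_comm]
    exact Finset.sum_congr rfl fun k _ => (Finset.sum_fiberwise _ (φ k) _).symm
  rw [h1, foldBias, ← Finset.sum_add_distrib, ← Finset.sum_add_distrib]
  refine Finset.sum_congr rfl fun z _ => ?_
  rw [crossSum, ← Finset.sum_add_distrib, ← Finset.sum_add_distrib]
  refine Finset.sum_congr rfl fun k _ => ?_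
  rw [Finset.sum_sub_distrib, Finset.sum_const, nsmul_eq_mul, sub_add_cancel,
    ← Finset.sum_add_distrib]
  refine Finset.sum_congr rfl fun j _ => ?_
  simp [fitError]

lemma measurable_foldBias {ν : Fin K → Measure (Obs S A Rmax)} [∀ k, IsProbabilityMeasure (ν k)]
    {N : Fin K → ℕ} {e : ∀ z : Fin Z, Fitted S A Rmax N Z z}
    (hem : ∀ z φ k, Measurable fun p : SubSample S A Rmax (trainIdx φ z) × Obs S A Rmax =>
      e z φ p.1 k p.2) (φ : FoldMap N Z) : Measurable (foldBias ν e φ) := by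
  unfold foldBias
  exact Finset.measurable_fun_sum _ fun z _ => Finset.measurable_fun_sum _ fun k _ =>
    ((measurable_integral_fitted (hem z) φ k).comp (measurable_restrict _)).const_mul _

/-- With folds of even sizes, the numbers of observations in a fold differ from the exact
proportions by at most one for each logger, so the bias is bounded. -/
lemma abs_foldBias_le {ν : Fin K → Measure (Obs S A Rmax)} {m : ℕ}
    {φ : FoldMap (scaled n m) Z} (hφ : EvenFolds φ)
    {e : ∀ z : Fin Z, Fitted S A Rmax (scaled n m) Z z} {d : Sample S A Rmax (scaled n m)}
    (hzero : ∀ z, ∑ k, (n k : ℝ) * ∫ o, e z φ (restrict _ d) k o ∂(ν k) = 0)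
    {b : Fin K → ℝ} (hb0 : ∀ k, 0 ≤ b k)
    (hb : ∀ z k, 0 < n k → |∫ o, e z φ (restrict _ d) k o ∂(ν k)| ≤ b k) :
    |foldBias ν e φ d| ≤ Z * ∑ k, b k := by
  have hz : ∀ z, |∑ k, ((foldIdx φ z k).card : ℝ) * ∫ o, e z φ (restrict _ d) k o ∂(ν k)|
      ≤ ∑ k, b k := fun z => by
    have h1 : ∑ k, ((foldIdx φ z k).card : ℝ) * ∫ o, e z φ (restrict _ d) k o ∂(ν k)
        = ∑ k, (((foldIdx φ z k).card : ℝ) - (scaled n m k : ℝ) / (Z : ℝ)) *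
          ∫ o, e z φ (restrict _ d) k o ∂(ν k) := by
      have h2 : ∑ k, ((scaled n m k : ℝ) / (Z : ℝ)) * ∫ o, e z φ (restrict _ d) k o ∂(ν k)
          = (m / Z : ℝ) * ∑ k, (n k : ℝ) * ∫ o, e z φ (restrict _ d) k o ∂(ν k) := by
        rw [Finset.mul_sum]
        refine Finset.sum_congr rfl fun k _ => ?_
        push_cast
        ring
      simp_rw [sub_mul]
      rw [Finset.sum_sub_distrib, h2, hzero z, mul_zero, sub_zero]
    rw [h1]
    refine (Finset.abs_sum_le_sum_abs _ _).trans (Finset.sum_le_sum fun k _ => ?_)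
    rw [abs_mul]
    rcases Nat.eq_zero_or_pos (n k) with h0 | h0
    · have hc : (foldIdx φ z k).card = 0 :=
        Nat.le_zero.1 ((Finset.card_le_univ _).trans (by simp [h0]))
      simp [hc, h0, hb0 k]
    · calc _ ≤ 1 * b k := mul_le_mul (hφ k z) (hb z k h0) (abs_nonneg _) zero_le_one
        _ = b k := one_mul _
  calc |foldBias ν e φ d| ≤ ∑ z : Fin Z, ∑ k, b k :=
        (Finset.abs_sum_le_sum_abs _ _).trans (Finset.sum_le_sum fun z _ => hz z)
    _ = Z * ∑ k, b k := by simp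

lemma foldBias_eq_zero {ν : Fin K → Measure (Obs S A Rmax)} (hn : 0 < total n)
    {N : Fin K → ℕ} {φ : FoldMap N Z} (hφ : ProportionalFolds n φ)
    {e : ∀ z : Fin Z, Fitted S A Rmax N Z z} {d : Sample S A Rmax N}
    (hzero : ∀ z, ∑ k, (n k : ℝ) * ∫ o, e z φ (restrict _ d) k o ∂(ν k) = 0) :
    foldBias ν e φ d = 0 := by
  refine Finset.sum_eq_zero fun z _ => ?_
  have hn0 : (total n : ℝ) ≠ 0 := (Nat.cast_pos.2 hn).ne'
  have hk : ∀ k, ((foldIdx φ z k).card : ℝ) = (partSize (foldIdx φ z) / total n : ℝ) * n k :=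
    fun k => by
      have h1 : ((foldIdx φ z k).card : ℝ) * total n = n k * partSize (foldIdx φ z) := by
        exact_mod_cast hφ k z
      field_simp
      linarith
  simp_rw [hk, mul_assoc]
  rw [← Finset.mul_sum, hzero z, mul_zero]

end Decomposition

/-! ### Asymptotic normality and bias of the estimator -/

section Assembly

variable {S A : Type*} [MeasurableSpace S] [MeasurableSpace A] {lam : Measure A} {Rmax : ℝ}
  {K : ℕ}

lemma Gam_univ (polE : Policy S lam) {N : Fin K → ℕ} (d : Sample S A Rmax N)
    (h : Fin K → S → A → ℝ) (g : S → A → ℝ) :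
    Gam polE (fun _ => Finset.univ) (restrict _ d) h g
      = (∑ k, ∑ j, score polE h g k (d k j)) / (total N : ℝ) := by
  have h1 : ∑ k, ∑ j, score polE h g k (restrict (fun _ => Finset.univ) d k j)
      = ∑ k, ∑ j, score polE h g k (d k j) :=
    Finset.sum_congr rfl fun k _ =>
      Finset.sum_coe_sort Finset.univ fun j => score polE h g k (d k j)
  rw [Gam, h1]
  simp [partSize, total]

lemma Policy.nonempty_action (pol : Policy S lam) (s : S) : Nonempty A := by
  by_contra hA
  rw [not_nonempty_iff] at hA
  simpa [Measure.eq_zero_of_isEmpty lam] using pol.lintegral_dens s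

end Assembly

end MultiLogger

end

theorem mainTheorem5
    {S A Ω : Type*} [MeasurableSpace S] [MeasurableSpace A] [MeasurableSpace Ω]
    (lam : Measure A) [SigmaFinite lam] (Rmax : ℝ) (K Z : ℕ) (hZ : 0 < Z)
    -- the data generating process
    (pS : Measure S) [IsProbabilityMeasure pS]
    (pR : Kernel (S × A) (Set.Icc (0 : ℝ) Rmax)) [IsMarkovKernel pR]
    (polE : MultiLogger.Policy S lam) (polL : Fin K → MultiLogger.Policy S lam)
    (n : Fin K → ℕ) (hn : 0 < MultiLogger.total n)
    (P : Measure Ω) [IsProbabilityMeasure P]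
    (X : Fin K → ℕ → Ω → MultiLogger.Obs S A Rmax)
    (hXm : ∀ k j, Measurable (X k j))
    (hXlaw : ∀ k j, P.map (X k j) = MultiLogger.obsLaw pS (polL k) pR)
    (hXindep : iIndepFun (fun p : Fin K × ℕ => X p.1 p.2) P)
    -- the random even partitions, drawn independently of the data
    (fold : (m : ℕ) → Ω → MultiLogger.FoldMap (MultiLogger.scaled n m) Z)
    (hfoldm : ∀ m, Measurable (fold m))
    (hfoldeven : ∀ m, ∀ᵐ ω ∂P, MultiLogger.EvenFolds (fold m ω))
    (hfoldindep : ∀ m, IndepFun (fold m) (fun ω (p : Fin K × ℕ) => X p.1 p.2 ω) P)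
    -- the functions `h`, `g` and their estimators
    (h : Fin K → S → A → ℝ) (hhm : ∀ k, Measurable (Function.uncurry (h k)))
    (g : S → A → ℝ) (hgm : Measurable (Function.uncurry g))
    (hhat : MultiLogger.Estimator S A Rmax n (Fin K → S → A → ℝ))
    (hhatm : ∀ m I k, Measurable
      (fun p : MultiLogger.SubSample S A Rmax I × S × A => hhat m I p.1 k p.2.1 p.2.2))
    (ghat : MultiLogger.Estimator S A Rmax n (S → A → ℝ))
    (hghatm : ∀ m I, Measurable
      (fun p : MultiLogger.SubSample S A Rmax I × S × A => ghat m I p.1 p.2.1 p.2.2))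
    -- `E_{π_*}[π^e(a ∣ s)²] < ∞`
    (hsq : ∀ k, 0 < n k → Integrable
      (fun o : MultiLogger.Obs S A Rmax => (polE.dens o.1.1 o.1.2) ^ 2)
      (MultiLogger.obsLaw pS (polL k) pR))
    -- uniform boundedness
    (C : ℝ) (hhC : ∀ k s a, |h k s a| ≤ C) (hgC : ∀ s a, |g s a| ≤ C)
    (hhatC : ∀ m, 0 < m → ∀ φ : MultiLogger.FoldMap (MultiLogger.scaled n m) Z,
      MultiLogger.EvenFolds φ → ∀ z d k s a, |hhat m (MultiLogger.trainIdx φ z) d k s a| ≤ C)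
    (hghatC : ∀ m, 0 < m → ∀ φ : MultiLogger.FoldMap (MultiLogger.scaled n m) Z,
      MultiLogger.EvenFolds φ → ∀ z d s a, |ghat m (MultiLogger.trainIdx φ z) d s a| ≤ C)
    -- the constraint on the weights
    (hhcon : MultiLogger.WeightConstraint n polL polE h)
    (hhatcon : ∀ m, 0 < m → ∀ φ : MultiLogger.FoldMap (MultiLogger.scaled n m) Z,
      MultiLogger.EvenFolds φ → ∀ z d,
        MultiLogger.WeightConstraint n polL polE (hhat m (MultiLogger.trainIdx φ z) d))
    -- consistency in `L₂`
    (hhcons : ∀ z : Fin Z, TendstoInMeasure P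
      (fun m ω => MultiLogger.l2Norm n pS polL pR (fun k s a =>
        hhat m (MultiLogger.trainIdx (fold m ω) z)
          (MultiLogger.restrict _ (MultiLogger.sampleOf X (MultiLogger.scaled n m) ω)) k s a
        - h k s a))
      atTop (fun _ => (0 : ℝ)))
    (hgcons : ∀ z : Fin Z, TendstoInMeasure P
      (fun m ω => MultiLogger.l2Norm n pS polL pR (fun _ s a =>
        ghat m (MultiLogger.trainIdx (fold m ω) z)
          (MultiLogger.restrict _ (MultiLogger.sampleOf X (MultiLogger.scaled n m) ω)) s a
        - g s a))
      atTop (fun _ => (0 : ℝ))) :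
    -- exact unbiasedness when the folds contain the loggers in the proportions `n_k / n`
    (∀ m, 0 < m → (∀ᵐ ω ∂P, MultiLogger.ProportionalFolds n (fold m ω)) →
      Integrable (fun ω => MultiLogger.JBI polE hhat ghat m (fold m ω)
        (MultiLogger.sampleOf X (MultiLogger.scaled n m) ω)) P ∧
      ∫ ω, MultiLogger.JBI polE hhat ghat m (fold m ω)
        (MultiLogger.sampleOf X (MultiLogger.scaled n m) ω) ∂P
        = MultiLogger.policyValue pS polE pR) ∧
    -- in general the bias is `O(1 / n')`
    (∃ B : ℝ, ∀ m, 0 < m →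
      Integrable (fun ω => MultiLogger.JBI polE hhat ghat m (fold m ω)
        (MultiLogger.sampleOf X (MultiLogger.scaled n m) ω)) P ∧
      |∫ ω, MultiLogger.JBI polE hhat ghat m (fold m ω)
        (MultiLogger.sampleOf X (MultiLogger.scaled n m) ω) ∂P
        - MultiLogger.policyValue pS polE pR|
        ≤ B / (MultiLogger.total (MultiLogger.scaled n m) : ℝ)) ∧
    -- `Γ(D; h, g)` has finite variance, and the estimator is asymptotically normal
    MemLp (fun ω => MultiLogger.Gam polE (fun _ => Finset.univ)
      (MultiLogger.restrict _ (MultiLogger.sampleOf X n ω)) h g) 2 P ∧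
    TendstoInDistribution
      (fun m ω => √(MultiLogger.total (MultiLogger.scaled n m) : ℝ) *
        (MultiLogger.JBI polE hhat ghat m (fold m ω)
          (MultiLogger.sampleOf X (MultiLogger.scaled n m) ω)
          - MultiLogger.policyValue pS polE pR))
      atTop (id : ℝ → ℝ) (fun _ => P)
      (gaussianReal 0 (Real.toNNReal ((MultiLogger.total n : ℝ) *
        variance (fun ω => MultiLogger.Gam polE (fun _ => Finset.univ)
          (MultiLogger.restrict _ (MultiLogger.sampleOf X n ω)) h g) P))) := by
  set J := MultiLogger.policyValue pS polE pR with hJ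
  set ν : Fin K → Measure (MultiLogger.Obs S A Rmax) :=
    fun k => MultiLogger.obsLaw pS (polL k) pR
  have hνp : ∀ k, IsProbabilityMeasure (ν k) := fun k =>
    MultiLogger.isProbabilityMeasure_obsLaw pS pR (polL k)
  have hC : 0 ≤ C := by
    obtain ⟨s⟩ : Nonempty S := nonempty_of_isProbabilityMeasure pS
    obtain ⟨a⟩ := polE.nonempty_action s
    exact (abs_nonneg _).trans (hgC s a)
  have hspos : ∀ m k, 0 < MultiLogger.scaled n m k → 0 < n k := fun m k hk =>
    Nat.pos_of_ne_zero fun h0 => by simp [MultiLogger.scaled, h0] at hk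
  have hNpos : ∀ m, 0 < m → (0 : ℝ) < MultiLogger.total (MultiLogger.scaled n m) := fun m hm => by
    rw [MultiLogger.total_scaled]
    exact Nat.cast_pos.2 (Nat.mul_pos hm hn)
  have hscm : ∀ k, Measurable fun o : MultiLogger.Obs S A Rmax => MultiLogger.score polE h g k o :=
    fun k => MultiLogger.measurable_score_right polE k (hhm k) hgm
  have hsc2 : ∀ k, 0 < n k → MemLp (fun o => MultiLogger.score polE h g k o) 2 (ν k) := fun k hk =>
    MultiLogger.memLp_score polE (polL k) (hsq k hk) (hhm k) hgm (hhC k) hgC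
  have hscmean := MultiLogger.sum_mul_integral_score n polL polE hsq hhm hgm hhC hgC hhcon
  obtain ⟨hΓ2, hclt⟩ := MultiLogger.tendstoInDistribution_stratified n hn hXm hXlaw hXindep
    hscm hsc2 hscmean
  set main : ℕ → Ω → ℝ := fun m ω => ∑ k, ∑ j, MultiLogger.score polE h g k
    (MultiLogger.sampleOf X (MultiLogger.scaled n m) ω k j) with hmain
  have hmain2 : ∀ m, MemLp (main m) 2 P ∧
      ∫ ω, main m ω ∂P = MultiLogger.total (MultiLogger.scaled n m) * J := fun m => by
    have := MultiLogger.memLp_sum_sample (P := P) (N := MultiLogger.scaled n m) hXm hXlaw hscm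
      (fun k hk => hsc2 k (hspos m k hk))
    refine ⟨this.1, this.2.trans ?_⟩
    rw [MultiLogger.total_scaled]
    push_cast
    simp_rw [mul_assoc]
    rw [← Finset.mul_sum, hscmean]
  set e : ∀ m (z : Fin Z), MultiLogger.Fitted S A Rmax (MultiLogger.scaled n m) Z z :=
    fun m z => MultiLogger.fitError polE h g hhat ghat m z
  have hem : ∀ m z φ k, Measurable fun p : MultiLogger.SubSample S A Rmax
      (MultiLogger.trainIdx φ z) × MultiLogger.Obs S A Rmax => e m z φ p.1 k p.2 :=
    fun m z φ k => (MultiLogger.measurable_score polE k (hhatm m _ k) (hghatm m _)).sub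
      ((hscm k).comp measurable_snd)
  have hhatm1 : ∀ m I (u : MultiLogger.SubSample S A Rmax I) k,
      Measurable (Function.uncurry (hhat m I u k)) := fun m I u k =>
    (hhatm m I k).comp measurable_prodMk_left
  have hghatm1 : ∀ m I (u : MultiLogger.SubSample S A Rmax I),
      Measurable (Function.uncurry (ghat m I u)) := fun m I u =>
    (hghatm m I).comp measurable_prodMk_left
  have heb : ∀ m, 0 < m → ∀ φ : MultiLogger.FoldMap (MultiLogger.scaled n m) Z,
      MultiLogger.EvenFolds φ → ∀ z u k o,
        |e m z φ u k o| ≤ 2 * MultiLogger.envelope polE C o := fun m hm φ hφ z u k o =>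
    MultiLogger.abs_score_sub_le hhC (hhatC m hm φ hφ z u) hgC (hghatC m hm φ hφ z u) k o
  have hG : ∀ k, 0 < n k →
      MemLp (fun o => 2 * MultiLogger.envelope (Rmax := Rmax) polE C o) 2 (ν k) := fun k hk =>
    (MultiLogger.memLp_envelope polE (polL k) C (hsq k hk)).const_mul 2
  -- `M m z` is centred given the other folds, and `v m z` bounds its conditional second moment
  -- divided by `m`
  set M : (m : ℕ) → Fin Z → Ω → ℝ := fun m z ω => MultiLogger.crossSum ν (e m z) (fold m ω)
    (MultiLogger.sampleOf X (MultiLogger.scaled n m) ω)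
  set v : ℕ → Fin Z → Ω → ℝ := fun m z ω => MultiLogger.strataSum n pS polL pR
    fun k o => (e m z (fold m ω) (MultiLogger.restrict _
      (MultiLogger.sampleOf X (MultiLogger.scaled n m) ω)) k o) ^ 2 with hv
  have hcross : ∀ m, 0 < m → ∀ z, MemLp (M m z) 2 P ∧ ∫ ω, M m z ω ∂P = 0 ∧
      ∫ ω, (M m z ω) ^ 2 ∂P ≤ m * ∫ ω, v m z ω ∂P := fun m hm z => by
    have := MultiLogger.crossSum_moments (P := P) (ν := ν) hXm hXlaw hXindep (hfoldm m)
      (hfoldindep m) (hfoldeven m) (hem m z) (fun k hk => hG k (hspos m k hk))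
      (fun φ hφ u k o => heb m hm φ hφ z u k o)
    refine ⟨this.1, this.2.1, this.2.2.trans_eq ?_⟩
    rw [← integral_const_mul]
    refine integral_congr_ae (ae_of_all _ fun ω => ?_)
    simp only [hv, MultiLogger.strataSum, Finset.mul_sum]
    refine Finset.sum_congr rfl fun k _ => ?_
    push_cast
    ring
  set bias : ℕ → Ω → ℝ := fun m ω => MultiLogger.foldBias ν (e m) (fold m ω)
    (MultiLogger.sampleOf X (MultiLogger.scaled n m) ω)
  have hbiasm : ∀ m, Measurable (bias m) := fun m =>
    MultiLogger.measurable_apply_fold_sample hXm (hfoldm m)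
      (MultiLogger.measurable_foldBias (hem m))
  have hzero : ∀ m, 0 < m → ∀ φ : MultiLogger.FoldMap (MultiLogger.scaled n m) Z,
      MultiLogger.EvenFolds φ → ∀ d z,
        ∑ k, (n k : ℝ) * ∫ o, e m z φ (MultiLogger.restrict _ d) k o ∂(ν k) = 0 :=
    fun m hm φ hφ d z => MultiLogger.sum_mul_integral_score_sub hsq hhm (hhatm1 m _ _) hgm
      (hghatm1 m _ _) hhC (hhatC m hm φ hφ z _) hgC (hghatC m hm φ hφ z _) hhcon
      (hhatcon m hm φ hφ z _)
  set b : Fin K → ℝ := fun k => |∫ o, 2 * MultiLogger.envelope polE C o ∂(ν k)|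
  set B : ℝ := Z * ∑ k, b k
  have hbiasB : ∀ m, 0 < m → ∀ᵐ ω ∂P, |bias m ω| ≤ B := fun m hm => by
    filter_upwards [hfoldeven m] with ω hω
    refine MultiLogger.abs_foldBias_le hω (hzero m hm _ hω _) (fun k => abs_nonneg _)
      fun z k hk => le_trans ?_ (le_abs_self _)
    exact MultiLogger.abs_integral_score_sub_le hsq hhC (hhatC m hm _ hω z _) hgC
      (hghatC m hm _ hω z _) k hk
  have hbiasi : ∀ m, 0 < m → MemLp (bias m) 2 P := fun m hm =>
    MemLp.of_bound (hbiasm m).aestronglyMeasurable B (hbiasB m hm)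
  have hJBI : ∀ m ω, MultiLogger.JBI polE hhat ghat m (fold m ω)
      (MultiLogger.sampleOf X (MultiLogger.scaled n m) ω)
      = (main m ω + (∑ z, M m z ω + bias m ω)) /
        (MultiLogger.total (MultiLogger.scaled n m) : ℝ) := fun m ω =>
    MultiLogger.JBI_eq ν polE h g hhat ghat m (fold m ω) _
  have hJBIint : ∀ m, 0 < m →
      Integrable (fun ω => MultiLogger.JBI polE hhat ghat m (fold m ω)
        (MultiLogger.sampleOf X (MultiLogger.scaled n m) ω)) P ∧
      ∫ ω, MultiLogger.JBI polE hhat ghat m (fold m ω)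
        (MultiLogger.sampleOf X (MultiLogger.scaled n m) ω) ∂P
        = J + (∫ ω, bias m ω ∂P) / (MultiLogger.total (MultiLogger.scaled n m) : ℝ) :=
    fun m hm => by
      have i1 := (hmain2 m).1.integrable (by norm_num)
      have i2 : ∀ z ∈ Finset.univ, Integrable (M m z) P := fun z _ =>
        (hcross m hm z).1.integrable (by norm_num)
      have i3 := (hbiasi m hm).integrable (by norm_num)
      have i4 : Integrable (fun ω => ∑ z, M m z ω) P := integrable_finsetSum _ i2
      simp_rw [hJBI]
      refine ⟨(i1.add (i4.add i3)).div_const _, ?_⟩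
      have hpos := (hNpos m hm).ne'
      have i5 : Integrable (fun ω => ∑ z, M m z ω + bias m ω) P := i4.add i3
      rw [integral_div, integral_add i1 i5, integral_add i4 i3, integral_finsetSum _ i2,
        Finset.sum_eq_zero fun z _ => (hcross m hm z).2.1, zero_add, (hmain2 m).2]
      field_simp
  refine ⟨fun m hm hprop => ⟨(hJBIint m hm).1, ?_⟩, ⟨B, fun m hm => ⟨(hJBIint m hm).1, ?_⟩⟩, ?_, ?_⟩
  · have : ∫ ω, bias m ω ∂P = 0 := by
      refine integral_eq_zero_of_ae ?_
      filter_upwards [hprop, hfoldeven m] with ω hω hω'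
      exact MultiLogger.foldBias_eq_zero hn hω (hzero m hm _ hω' _)
    rw [(hJBIint m hm).2, this, zero_div, add_zero]
  · rw [(hJBIint m hm).2, add_sub_cancel_left, abs_div, abs_of_pos (hNpos m hm)]
    refine div_le_div_of_nonneg_right ?_ (hNpos m hm).le
    have := norm_integral_le_of_norm_le_const (μ := P) (f := bias m) (hbiasB m hm)
    simpa using this
  · simp_rw [MultiLogger.Gam_univ, div_eq_inv_mul]
    exact hΓ2.const_mul _
  · simp_rw [MultiLogger.Gam_univ]
    refine tendstoInDistribution_of_tendstoInMeasure_sub _ _ hclt ?_ ?_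
    swap
    · intro m
      have : Measurable fun ω => MultiLogger.JBI polE hhat ghat m (fold m ω)
          (MultiLogger.sampleOf X (MultiLogger.scaled n m) ω) := by
        simp_rw [hJBI]
        refine Measurable.div_const (Measurable.add ?_ (Measurable.add ?_ (hbiasm m))) _
        · exact Finset.measurable_fun_sum _ fun k _ => Finset.measurable_fun_sum _ fun j _ =>
            (hscm k).comp (hXm k j)
        · exact Finset.measurable_fun_sum _ fun z _ =>
            MultiLogger.measurable_apply_fold_sample hXm (hfoldm m)
              (MultiLogger.measurable_crossSum (hem m z))
      exact ((this.sub_const J).const_mul _).aemeasurable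
    -- bounded convergence, with the truncation level as the parameter
    have hvlim : ∀ z, Tendsto (fun m => ∫ ω, v m z ω ∂P) atTop (𝓝 0) := fun z => by
      set L : ℝ := 3 * ((Rmax + C) ^ 2 + C ^ 2 + C)
      have hL0 : 0 ≤ L := by positivity
      refine MultiLogger.tendsto_integral_of_le_sq_add_sq
        (a := fun N => L * ((1 + (N : ℝ) ^ 2) * (MultiLogger.total n : ℝ)))
        (b := fun N => L * (4 * C ^ 2 * MultiLogger.tailSum n pS polL pR polE (N : ℝ)))
        (D := ∑ k, (n k : ℝ) * ∫ o, (2 * MultiLogger.envelope polE C o) ^ 2 ∂(ν k))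
        ?_ ?_ ?_ ?_ ?_ (hhcons z) (hgcons z) (fun N => by positivity) ?_ ?_
      · intro m
        refine MultiLogger.measurable_apply_fold_sample (F := fun φ d =>
          MultiLogger.strataSum n pS polL pR fun k o =>
            (e m z φ (MultiLogger.restrict _ d) k o) ^ 2) hXm (hfoldm m) fun φ => ?_
        refine Finset.measurable_fun_sum _ fun k _ => Measurable.const_mul ?_ _
        exact (MultiLogger.measurable_integral_fitted (ν := ν)
          (e := fun φ u k o => (e m z φ u k o) ^ 2) (fun φ k => (hem m z φ k).pow_const 2)
          φ k).comp (MultiLogger.measurable_restrict _)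
      · exact fun m ω => MultiLogger.strataSum_nonneg fun k o => sq_nonneg _
      · intro m hm
        filter_upwards [hfoldeven m] with ω hω
        refine Finset.sum_le_sum fun k _ => ?_
        rcases Nat.eq_zero_or_pos (n k) with h0 | h0
        · simp [h0]
        · refine mul_le_mul_of_nonneg_left ?_ (Nat.cast_nonneg _)
          refine integral_mono_of_nonneg (ae_of_all _ fun _ => sq_nonneg _)
            (hG k h0).integrable_sq (ae_of_all _ fun o => ?_)
          have := abs_le.1 (heb m hm _ hω z (MultiLogger.restrict _
            (MultiLogger.sampleOf X (MultiLogger.scaled n m) ω)) k o)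
          exact sq_le_sq' (by linarith [this.1]) this.2
      · exact fun m ω => Real.sqrt_nonneg _
      · exact fun m ω => Real.sqrt_nonneg _
      · simpa using ((MultiLogger.tendsto_tailSum hsq).const_mul (4 * C ^ 2)).const_mul L
      · intro m hm
        filter_upwards [hfoldeven m] with ω hω N
        refine (MultiLogger.strataSum_score_sub_le hn hsq hC hhm (hhatm1 m _ _) hgm
          (hghatm1 m _ _) hhC (hhatC m hm _ hω z _) hgC (hghatC m hm _ hω z _) hhcon N).trans_eq ?_
        ring
    have hrem : TendstoInMeasure P (fun m ω =>
        √(MultiLogger.total (MultiLogger.scaled n m) : ℝ) /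
          MultiLogger.total (MultiLogger.scaled n m) * (∑ z, M m z ω + bias m ω))
        atTop (fun _ => (0 : ℝ)) := by
      have hsum2 : ∀ m, 0 < m → MemLp (fun ω => ∑ z, M m z ω) 2 P := fun m hm =>
        memLp_finsetSum _ fun z _ => (hcross m hm z).1
      refine MultiLogger.tendstoInMeasure_of_tendsto_integral_sq
        (c := fun m => 2 * Z / MultiLogger.total n * (∑ z, ∫ ω, v m z ω ∂P)
          + 2 * B ^ 2 / MultiLogger.total n / m)
        (fun m hm => ((hsum2 m hm).add (hbiasi m hm)).const_mul _) (fun m hm => ?_) ?_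
      · have hm0 : (0 : ℝ) < m := Nat.cast_pos.2 hm
        have hpt : ∀ᵐ ω ∂P, (√(MultiLogger.total (MultiLogger.scaled n m) : ℝ) /
            MultiLogger.total (MultiLogger.scaled n m) * (∑ z, M m z ω + bias m ω)) ^ 2
            ≤ (MultiLogger.total (MultiLogger.scaled n m) : ℝ)⁻¹ *
              (2 * Z * ∑ z, (M m z ω) ^ 2 + 2 * B ^ 2) := by
          filter_upwards [hbiasB m hm] with ω hω
          have hpos := hNpos m hm
          rw [mul_pow, div_pow, Real.sq_sqrt hpos.le]
          have e1 : (MultiLogger.total (MultiLogger.scaled n m) : ℝ) /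
              (MultiLogger.total (MultiLogger.scaled n m) : ℝ) ^ 2
              = (MultiLogger.total (MultiLogger.scaled n m) : ℝ)⁻¹ := by
            field_simp
          rw [e1]
          refine mul_le_mul_of_nonneg_left ?_ (inv_nonneg.2 hpos.le)
          have e2 : (∑ z, M m z ω) ^ 2 ≤ Z * ∑ z, (M m z ω) ^ 2 := by
            simpa using sq_sum_le_card_mul_sum_sq (s := Finset.univ) (f := fun z => M m z ω)
          have e3 : (bias m ω) ^ 2 ≤ B ^ 2 :=
            sq_le_sq' (by linarith [(abs_le.1 hω).1]) (abs_le.1 hω).2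
          have e4 := add_sq_le (a := ∑ z, M m z ω) (b := bias m ω)
          linarith
        have i1 : ∀ z ∈ Finset.univ, Integrable (fun ω => (M m z ω) ^ 2) P := fun z _ =>
          (hcross m hm z).1.integrable_sq
        have i2 : Integrable (fun ω => 2 * Z * ∑ z, (M m z ω) ^ 2) P :=
          (integrable_finsetSum _ i1).const_mul _
        have i3 : Integrable (fun ω => 2 * Z * ∑ z, (M m z ω) ^ 2 + 2 * B ^ 2) P :=
          i2.add (integrable_const _)
        refine (integral_mono_of_nonneg (ae_of_all _ fun _ => sq_nonneg _)
          (i3.const_mul _) hpt).trans ?_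
        rw [integral_const_mul, integral_add i2 (integrable_const _), integral_const_mul,
          integral_finsetSum _ i1]
        have hle : ∑ z, ∫ ω, (M m z ω) ^ 2 ∂P ≤ m * ∑ z, ∫ ω, v m z ω ∂P := by
          rw [Finset.mul_sum]
          exact Finset.sum_le_sum fun z _ => (hcross m hm z).2.2
        calc _ ≤ (MultiLogger.total (MultiLogger.scaled n m) : ℝ)⁻¹ *
              (2 * Z * (m * ∑ z, ∫ ω, v m z ω ∂P) + 2 * B ^ 2) := by
              refine mul_le_mul_of_nonneg_left ?_ (inv_nonneg.2 (hNpos m hm).le)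
              simpa using mul_le_mul_of_nonneg_left hle (by positivity : (0 : ℝ) ≤ 2 * Z)
          _ = _ := by
              rw [MultiLogger.total_scaled]
              push_cast
              field_simp
      · have h1 : Tendsto (fun m => ∑ z, ∫ ω, v m z ω ∂P) atTop (𝓝 (∑ _z : Fin Z, 0)) :=
          tendsto_finsetSum _ fun z _ => hvlim z
        have h2 := tendsto_const_div_atTop_nhds_zero_nat (2 * B ^ 2 / MultiLogger.total n)
        simpa using (h1.const_mul (2 * Z / MultiLogger.total n : ℝ)).add h2
    convert hrem using 1
    · ext m ω
      simp only [Pi.sub_apply, hJBI, hmain, hJ]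
      ring
    · rfl
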